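/- Let $n>4$ be an integer, $\alpha=\sqrt n-1$, $\lambda\ge 0$, $c_0>0$, $c_1\in\mathbb R$ and $c_2=\frac{(n-1)(\alpha-1)}{2}$. Then there is a constant $0<\delta_0<1$ such that the equation $$2r^2h(r)h_{rr}(r)=(n-1)h(r)(h(r)-1)+rh_r(r)\bigl(rh_r(r)-\lambda r-(n-1)\bigr),\qquad h(r)>0,$$ has a unique solution $h\in C^2((0,\infty))$ in $(0,\infty)$ which satisfies $\lim_{r\to0^+}r^{\alpha}h(r)=c_0$ and, for all $0<r\le\delta_0$, $$h(r)=\frac1{r^{\alpha}}\Bigl\{c_0-\frac{c_2}{\alpha}r^{\alpha}+\Bigl(\frac{c_1}{\alpha+1}-\frac{\alpha\lambda}{2(\alpha+1)^2}\Bigr)r^{\alpha+1}+\frac{\alpha\lambda}{2\alpha+2}r^{\alpha+1}\log r+\frac{c_2^2+(n-1)c_2}{4c_0\alpha(\alpha-1)}r^{2\alpha}+o(1)r^{2\alpha}\Bigr\}.$$ Moreover, this solution satisfies, for all $0<r\le\delta_0$, $$h_r(r)=\frac1{r^{\alpha+1}}\Bigl\{-\alpha c_0+\Bigl(\frac{c_1}{\alpha+1}+\frac{\alpha^2\lambda}{2(\alpha+1)^2}\Bigr)r^{\alpha+1}+\frac{\alpha\lambda}{2\alpha+2}r^{\alpha+1}\log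 r+\frac{c_2^2+(n-1)c_2}{4c_0(\alpha-1)}r^{2\alpha}+o(1)r^{2\alpha}\Bigr\}.$$ Here $o(1)$ denotes a function of $r$ (possibly different in the two expansions) that tends to $0$ as $r\to0^+$. -/

import Mathlib

open Set Filter Topology

noncomputable section

/-- `h` is a `C²` solution on `(0,∞)` of
`2 r² h h_rr = (n-1) h (h-1) + r h_r (r h_r - λ r - (n-1))`, `h > 0`. -/
def IsSolitonSolution (n : ℕ) (lam : ℝ) (h : ℝ → ℝ) : Prop :=
  ContDiffOn ℝ 2 h (Ioi 0) ∧
    ∀ r : ℝ, 0 < r → 0 < h r ∧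
      2 * r ^ 2 * h r * deriv (deriv h) r =
        ((n : ℝ) - 1) * h r * (h r - 1) +
          r * deriv h r * (r * deriv h r - lam * r - ((n : ℝ) - 1))

/-- The blow-up exponent `α = √n - 1`. -/
def blowUpExponent (n : ℕ) : ℝ := √(n : ℝ) - 1

/-- The constant `c₂ = (n-1)(α-1)/2`. -/
def cTwo (n : ℕ) : ℝ := ((n : ℝ) - 1) * (blowUpExponent n - 1) / 2

/-- The blow-up rate `r ^ α h(r) → c₀` as `r → 0⁺`. -/
def HasBlowUpRate (α c₀ : ℝ) (h : ℝ → ℝ) : Prop :=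
  Tendsto (fun r : ℝ => r ^ α * h r) (𝓝[>] 0) (𝓝 c₀)

/-- The expansion of `h` on `(0, δ₀]`; the function `e` is the `o(1)` as `r → 0⁺`. -/
def HasExpansion (n : ℕ) (lam c₀ c₁ δ₀ : ℝ) (h : ℝ → ℝ) : Prop :=
  let α := blowUpExponent n
  let c₂ := cTwo n
  ∃ e : ℝ → ℝ, Tendsto e (𝓝[>] 0) (𝓝 0) ∧
    ∀ r : ℝ, 0 < r → r ≤ δ₀ →
      h r = 1 / r ^ α *
        (c₀ - c₂ / α * r ^ α
          + (c₁ / (α + 1) - α * lam / (2 * (α + 1) ^ 2)) * r ^ (α + 1)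
          + α * lam / (2 * α + 2) * r ^ (α + 1) * Real.log r
          + (c₂ ^ 2 + ((n : ℝ) - 1) * c₂) / (4 * c₀ * α * (α - 1)) * r ^ (2 * α)
          + e r * r ^ (2 * α))

/-- The expansion of `h_r` on `(0, δ₀]`; the function `e` is the `o(1)` as `r → 0⁺`. -/
def HasDerivExpansion (n : ℕ) (lam c₀ c₁ δ₀ : ℝ) (h : ℝ → ℝ) : Prop :=
  let α := blowUpExponent n
  let c₂ := cTwo n
  ∃ e : ℝ → ℝ, Tendsto e (𝓝[>] 0) (𝓝 0) ∧
    ∀ r : ℝ, 0 < r → r ≤ δ₀ →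
      deriv h r = 1 / r ^ (α + 1) *
        (-α * c₀
          + (c₁ / (α + 1) + α ^ 2 * lam / (2 * (α + 1) ^ 2)) * r ^ (α + 1)
          + α * lam / (2 * α + 2) * r ^ (α + 1) * Real.log r
          + (c₂ ^ 2 + ((n : ℝ) - 1) * c₂) / (4 * c₀ * (α - 1)) * r ^ (2 * α)
          + e r * r ^ (2 * α))

end

/-! Write m = n - 1 = α² + 2α and pass from h to H = r^α h and B = h_r + (α h + c₂)/r - (αλ/2) log
r. With q = α h + r h_r = -c₂ + (αλ/2) r log r + r B, the equation becomes H_r = r^(α-1) q and B_r =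
r^(α-2) q (q - λ r - m) / (2H). Since n > 4 means α > 1, the weight r^(α-2) is integrable at 0. In
the time variable ρ = r^(α-1) the system for (log H, B) is smooth in the unknowns and continuous in
ρ up to ρ = 0, so the singular problem is an ordinary initial value problem with data (log c₀, c₁):
the free constant c₁ is the limit of B.

The slope of B at ρ = 0 (`tendsto_remainder`) yields the r^(2α) coefficient, and integrating H_r
yields the expansion of h (`tendsto_expansion`); the definition of B turns both into the expansion
of h_r.

The local solution continues to (0, ∞) because log h and h_r / h stay bounded on bounded intervals
(`logField_apriori`).

A competitor is only known to have the expansion of h, with no information on h_r.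
`tendsto_remainder_of_expansion` recovers B → c₁ from it, by the mean value theorem on [r, 2r] and a
bound on the oscillation of arctan B. Uniqueness for the regular system then applies. -/

noncomputable section

/-! ### Integral curves of a C¹ field driven by a merely continuous parameter. -/

section ParametrizedODE

variable {P E : Type*} [NormedAddCommGroup E] [NormedSpace ℝ E]

/-- The curve `y` solves `y' = G (c t, y)` on `[a, b]`, with one-sided derivatives at the ends. -/
def IsIntegralCurveOnIcc (G : P × E → E) (c : ℝ → P) (a b : ℝ) (y : ℝ → E) : Prop :=
  ∀ t ∈ Icc a b, HasDerivWithinAt y (G (c t, y t)) (Icc a b) t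

theorem IsIntegralCurveOnIcc.mono {G : P × E → E} {c : ℝ → P} {a b a' b' : ℝ} {y : ℝ → E}
    (h : IsIntegralCurveOnIcc G c a b y) (ha : a ≤ a') (hb : b' ≤ b) :
    IsIntegralCurveOnIcc G c a' b' y := fun t ht =>
  (h t (Icc_subset_Icc ha hb ht)).mono (Icc_subset_Icc ha hb)

theorem IsIntegralCurveOnIcc.continuousOn {G : P × E → E} {c : ℝ → P} {a b : ℝ} {y : ℝ → E}
    (h : IsIntegralCurveOnIcc G c a b y) : ContinuousOn y (Icc a b) :=
  fun t ht => (h t ht).continuousWithinAt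

theorem IsIntegralCurveOnIcc.hasDerivWithinAt_Ici {G : P × E → E} {c : ℝ → P} {a b : ℝ}
    {y : ℝ → E} (h : IsIntegralCurveOnIcc G c a b y) {t : ℝ} (ht : t ∈ Ico a b) :
    HasDerivWithinAt y (G (c t, y t)) (Ici t) t :=
  (h t (Ico_subset_Icc_self ht)).mono_of_mem_nhdsWithin (Icc_mem_nhdsGE_of_mem ht)

theorem IsIntegralCurveOnIcc.hasDerivAt {G : P × E → E} {c : ℝ → P} {a b : ℝ}
    {y : ℝ → E} (h : IsIntegralCurveOnIcc G c a b y) {t : ℝ} (ht : t ∈ Ioo a b) :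
    HasDerivAt y (G (c t, y t)) t :=
  (h t (Ioo_subset_Icc_self ht)).hasDerivAt (Icc_mem_nhds ht.1 ht.2)

/-- A `C¹` map agrees on a ball with a bounded Lipschitz map. -/
theorem exists_lipschitz_bounded_eqOn_closedBall {X F : Type*} [NormedAddCommGroup X]
    [NormedSpace ℝ X] [FiniteDimensional ℝ X] [NormedAddCommGroup F] [NormedSpace ℝ F]
    {G : X → F} (hG : ContDiff ℝ 1 G) (R : ℝ) :
    ∃ (H : X → F) (K C : NNReal), LipschitzWith K H ∧ (∀ x, ‖H x‖ ≤ C) ∧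
      ∀ x, ‖x‖ ≤ R → H x = G x := by
  have hR : 0 < max R 1 := lt_max_of_lt_right one_pos
  -- A bump needs a positive inner radius, while `R` is arbitrary.
  let χ : ContDiffBump (0 : X) := ⟨max R 1, max R 1 + 1, hR, by linarith⟩
  have hc : ContDiff ℝ 1 (fun x => χ x • G x) := χ.contDiff.smul hG
  have hs : HasCompactSupport (fun x => χ x • G x) := χ.hasCompactSupport.smul_right
  obtain ⟨K, hK⟩ := hc.lipschitzWith_of_hasCompactSupport hs one_ne_zero
  obtain ⟨C, hC⟩ := hs.exists_bound_of_continuous hc.continuous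
  refine ⟨_, K, C.toNNReal, hK, fun x => (hC x).trans (Real.le_coe_toNNReal C), fun x hx => ?_⟩
  have : χ x = 1 := χ.one_of_mem_closedBall (by
    rw [mem_closedBall_zero_iff]; exact hx.trans (le_max_left R 1))
  simp [this]

variable [NormedAddCommGroup P] [NormedSpace ℝ P] [FiniteDimensional ℝ P]
  [FiniteDimensional ℝ E]

/-- Two integral curves of a `C¹` field with the same initial value agree. -/
theorem IsIntegralCurveOnIcc.eqOn {G : P × E → E} (hG : ContDiff ℝ 1 G) {c : ℝ → P} {a b : ℝ}
    (hc : ContinuousOn c (Icc a b)) {y z : ℝ → E} (hy : IsIntegralCurveOnIcc G c a b y)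
    (hz : IsIntegralCurveOnIcc G c a b z) (h : y a = z a) : EqOn y z (Icc a b) := by
  obtain ⟨Rc, hRc⟩ := isCompact_Icc.exists_bound_of_continuousOn hc
  obtain ⟨Ry, hRy⟩ := isCompact_Icc.exists_bound_of_continuousOn hy.continuousOn
  obtain ⟨Rz, hRz⟩ := isCompact_Icc.exists_bound_of_continuousOn hz.continuousOn
  -- Both curves stay in a ball where the field equals a globally Lipschitz one, so Grönwall
  -- uniqueness applies.
  obtain ⟨H, K, -, hK, -, hH⟩ := exists_lipschitz_bounded_eqOn_closedBall hG (max Rc (max Ry Rz))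
  have hHG : ∀ t ∈ Icc a b, ∀ w : E, ‖w‖ ≤ max Ry Rz → H (c t, w) = G (c t, w) := by
    intro t ht w hw
    apply hH
    rw [Prod.norm_mk]
    exact max_le_max (hRc t ht) hw
  refine ODE_solution_unique (v := fun t w => H (c t, w)) (K := K) (fun t => ?_)
    hy.continuousOn (fun t ht => ?_) hz.continuousOn (fun t ht => ?_) h
  · have := hK.comp (LipschitzWith.prodMk_left (c t))
    rwa [mul_one] at this
  · have ht' := Ico_subset_Icc_self ht
    show HasDerivWithinAt y (H (c t, y t)) (Ici t) t
    rw [hHG t ht' _ ((hRy t ht').trans (le_max_left _ _))]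
    exact hy.hasDerivWithinAt_Ici ht
  · have ht' := Ico_subset_Icc_self ht
    show HasDerivWithinAt z (H (c t, z t)) (Ici t) t
    rw [hHG t ht' _ ((hRz t ht').trans (le_max_right _ _))]
    exact hz.hasDerivWithinAt_Ici ht

/-- Existence of a curve on all of `[a, b]` which follows the field `G` as long as it stays
in a given ball. -/
theorem exists_curve_of_norm_le {G : P × E → E} (hG : ContDiff ℝ 1 G) {c : ℝ → P} {a b : ℝ}
    (hab : a ≤ b) (hc : ContinuousOn c (Icc a b)) (y₀ : E) (R : ℝ) :
    ∃ y : ℝ → E, y a = y₀ ∧ ContinuousOn y (Icc a b) ∧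
      ∀ d ≤ b, (∀ t ∈ Icc a d, ‖y t‖ ≤ R) → IsIntegralCurveOnIcc G c a d y := by
  obtain ⟨Rc, hRc⟩ := isCompact_Icc.exists_bound_of_continuousOn hc
  obtain ⟨H, K, C, hK, hC, hH⟩ := exists_lipschitz_bounded_eqOn_closedBall hG (max Rc R)
  -- The truncated field is bounded by `C` everywhere, so the ball of radius `C * (b - a)` serves
  -- for all of `[a, b]`.
  have hPL : IsPicardLindelof (fun t w => H (c t, w)) (tmin := a) (tmax := b)
      ⟨a, left_mem_Icc.2 hab⟩ y₀ (C * (b - a).toNNReal) 0 C K := by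
    refine ⟨fun t _ => ?_, fun w _ => ?_, fun t _ w _ => hC _, ?_⟩
    · have := hK.comp (LipschitzWith.prodMk_left (c t))
      rw [mul_one] at this
      exact this.lipschitzOnWith
    · exact hK.continuous.comp_continuousOn (hc.prodMk continuousOn_const)
    · simp [hab]
  obtain ⟨y, hy0, hy⟩ := hPL.exists_eq_forall_mem_Icc_hasDerivWithinAt₀
  refine ⟨y, hy0, fun t ht => (hy t ht).continuousWithinAt, fun d hd hR t ht => ?_⟩
  have ht' : t ∈ Icc a b := Icc_subset_Icc le_rfl hd ht
  have := (hy t ht').mono (Icc_subset_Icc le_rfl hd)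
  rwa [hH] at this
  rw [Prod.norm_mk]
  exact max_le_max (hRc t ht') (hR t ht)

/-- Local existence of integral curves. -/
theorem exists_isIntegralCurveOnIcc_local {G : P × E → E} (hG : ContDiff ℝ 1 G) {c : ℝ → P}
    {a b : ℝ} (hab : a < b) (hc : ContinuousOn c (Icc a b)) (y₀ : E) :
    ∃ d, a < d ∧ d ≤ b ∧ ∃ y : ℝ → E, y a = y₀ ∧ IsIntegralCurveOnIcc G c a d y := by
  obtain ⟨y, hy0, hcont, hy⟩ := exists_curve_of_norm_le hG hab.le hc y₀ (‖y₀‖ + 1)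
  have h1 : ∀ᶠ t in 𝓝[≥] a, ‖y t‖ < ‖y₀‖ + 1 := by
    have h2 : Tendsto (fun t => ‖y t‖) (𝓝[≥] a) (𝓝 ‖y₀‖) := by
      have := (hcont a (left_mem_Icc.2 hab.le)).mono_of_mem_nhdsWithin
        (s := Ici a) (Icc_mem_nhdsGE hab)
      simpa [hy0] using this.norm.tendsto
    exact h2.eventually (gt_mem_nhds (by linarith))
  obtain ⟨u, hu, hsub⟩ := (mem_nhdsGE_iff_exists_Icc_subset).1 h1
  refine ⟨min u b, lt_min hu hab, min_le_right _ _, y, hy0, hy _ (min_le_right _ _) ?_⟩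
  intro t ht
  exact (hsub ⟨ht.1, ht.2.trans (min_le_left _ _)⟩ : ‖y t‖ < ‖y₀‖ + 1).le

/-- An a priori bound on integral curves gives existence on the whole interval. -/
theorem exists_isIntegralCurveOnIcc_of_bound {G : P × E → E} (hG : ContDiff ℝ 1 G) {c : ℝ → P}
    {a b : ℝ} (hab : a ≤ b) (hc : ContinuousOn c (Icc a b)) (y₀ : E) (R : ℝ)
    (hR : ∀ d ∈ Icc a b, ∀ y : ℝ → E, y a = y₀ → IsIntegralCurveOnIcc G c a d y → ‖y d‖ ≤ R) :
    ∃ y : ℝ → E, y a = y₀ ∧ IsIntegralCurveOnIcc G c a b y := by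
  obtain ⟨y, hy0, hcont, hy⟩ := exists_curve_of_norm_le hG hab hc y₀ (R + 1)
  refine ⟨y, hy0, hy b le_rfl ?_⟩
  have hcn : ContinuousOn (fun t => ‖y t‖) (Icc a b) := hcont.norm
  by_contra! hcon
  obtain ⟨t₁, ht₁, hbig⟩ := hcon
  set S := {t ∈ Icc a b | R + 1 ≤ ‖y t‖} with hS
  have hSc : IsCompact S := by
    have : IsClosed S := hcn.preimage_isClosed_of_isClosed isClosed_Icc isClosed_Ici
    exact isCompact_Icc.of_isClosed_subset this (fun t ht => ht.1)
  -- `τ` is the first time the norm reaches `R + 1`. Up to `τ` the curve follows `G`, so the a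
  -- priori bound `R` holds at `τ`, a contradiction.
  obtain ⟨τ, hτ, hmin⟩ := hSc.exists_isLeast ⟨t₁, ht₁, hbig.le⟩
  have hlt : ∀ t ∈ Ico a τ, ‖y t‖ ≤ R + 1 := by
    intro t ht
    by_contra! h
    exact (hmin ⟨⟨ht.1, ht.2.le.trans hτ.1.2⟩, h.le⟩).not_gt ht.2
  have haτ : a < τ := by
    refine lt_of_le_of_ne hτ.1.1 fun h => ?_
    -- On the degenerate interval `[a, a]` every curve is integral, so the a priori bound already
    -- controls `y₀`.
    have := hR a ⟨le_rfl, hab⟩ (fun _ => y₀) rfl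
    have h2 : ‖y₀‖ ≤ R := by
      apply this
      intro t ht
      have : t = a := le_antisymm ht.2 ht.1
      subst this
      rw [Icc_self]
      exact HasFDerivWithinAt.of_subsingleton subsingleton_singleton
    have h3 := hτ.2
    rw [← h, hy0] at h3
    linarith
  have hle : ‖y τ‖ ≤ R + 1 := by
    have h1 : Tendsto (fun t => ‖y t‖) (𝓝[<] τ) (𝓝 ‖y τ‖) :=
      ((hcn τ hτ.1).mono_of_mem_nhdsWithin (s := Iio τ)
        (mem_of_superset (Ico_mem_nhdsLT haτ)
          (Ico_subset_Icc_self.trans (Icc_subset_Icc le_rfl hτ.1.2)))).tendsto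
    exact le_of_tendsto h1 (mem_of_superset (Ico_mem_nhdsLT haτ) hlt)
  have hsol : IsIntegralCurveOnIcc G c a τ y := hy τ hτ.1.2 fun t ht => by
    rcases ht.2.lt_or_eq with h | h
    · exact hlt t ⟨ht.1, h⟩
    · rw [h]; exact hle
  have := hR τ hτ.1 y hy0 hsol
  linarith [hτ.2]

end ParametrizedODE

section GlobalCurve

variable {P E : Type*} [NormedAddCommGroup E] [NormedSpace ℝ E]
  [NormedAddCommGroup P] [NormedSpace ℝ P] [FiniteDimensional ℝ P] [FiniteDimensional ℝ E]

/-- Integral curves on all intervals `[a, T]` with a common initial value glue together. -/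
theorem exists_isIntegralCurveOnIcc_forall {G : P × E → E} (hG : ContDiff ℝ 1 G) {c : ℝ → P}
    {a : ℝ} (hc : ContinuousOn c (Ici a)) {y₀ : E}
    (h : ∀ T, a ≤ T → ∃ y : ℝ → E, y a = y₀ ∧ IsIntegralCurveOnIcc G c a T y) :
    ∃ y : ℝ → E, y a = y₀ ∧ ∀ T, a ≤ T → IsIntegralCurveOnIcc G c a T y := by
  choose! Y hY0 hY using h
  have key : ∀ T, a ≤ T → EqOn (fun t => Y (t + 1) t) (Y T) (Icc a T) := by
    intro T hT t ht
    have h1 : a ≤ t + 1 := by linarith [ht.1]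
    exact ((hY _ h1).mono le_rfl (by linarith)).eqOn hG (hc.mono Icc_subset_Ici_self)
      ((hY T hT).mono le_rfl ht.2) ((hY0 _ h1).trans (hY0 T hT).symm) (right_mem_Icc.2 ht.1)
  refine ⟨fun t => Y (t + 1) t, hY0 _ (by linarith), fun T hT t ht => ?_⟩
  have h2 := (hY T hT t ht).congr (key T hT) (key T hT ht)
  rwa [← key T hT ht] at h2

end GlobalCurve

theorem hasDerivWithinAt_fst {y : ℝ → ℝ × ℝ} {y' : ℝ × ℝ} {s : Set ℝ} {t : ℝ}
    (h : HasDerivWithinAt y y' s t) : HasDerivWithinAt (fun t => (y t).1) y'.1 s t :=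
  (ContinuousLinearMap.fst ℝ ℝ ℝ).hasFDerivAt.comp_hasDerivWithinAt t h

theorem hasDerivWithinAt_snd {y : ℝ → ℝ × ℝ} {y' : ℝ × ℝ} {s : Set ℝ} {t : ℝ}
    (h : HasDerivWithinAt y y' s t) : HasDerivWithinAt (fun t => (y t).2) y'.2 s t :=
  (ContinuousLinearMap.snd ℝ ℝ ℝ).hasFDerivAt.comp_hasDerivWithinAt t h

theorem hasDerivAt_fst {y : ℝ → ℝ × ℝ} {y' : ℝ × ℝ} {t : ℝ}
    (h : HasDerivAt y y' t) : HasDerivAt (fun t => (y t).1) y'.1 t :=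
  (ContinuousLinearMap.fst ℝ ℝ ℝ).hasFDerivAt.comp_hasDerivAt t h

theorem hasDerivAt_snd {y : ℝ → ℝ × ℝ} {y' : ℝ × ℝ} {t : ℝ}
    (h : HasDerivAt y y' t) : HasDerivAt (fun t => (y t).2) y'.2 t :=
  (ContinuousLinearMap.snd ℝ ℝ ℝ).hasFDerivAt.comp_hasDerivAt t h

/-! ### The soliton equation away from 0, and continuation to infinity. -/

/-- The second derivative prescribed by the soliton equation, with `m = n - 1`. -/
def solitonAccel (m lam r h p : ℝ) : ℝ :=
  (m * h * (h - 1) + r * p * (r * p - lam * r - m)) / (2 * r ^ 2 * h)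

/-- `h` is a positive solution of the soliton equation on `s`, with derivative `p`. -/
def IsSolitonOn (m lam : ℝ) (h p : ℝ → ℝ) (s : Set ℝ) : Prop :=
  ∀ r ∈ s, 0 < h r ∧ HasDerivAt h (p r) r ∧ HasDerivAt p (solitonAccel m lam r (h r) (p r)) r

theorem IsSolitonOn.mono {m lam : ℝ} {h p : ℝ → ℝ} {s t : Set ℝ} (H : IsSolitonOn m lam h p s)
    (hts : t ⊆ s) : IsSolitonOn m lam h p t := fun r hr => H r (hts hr)

theorem IsSolitonOn.congr {m lam : ℝ} {h p h' p' : ℝ → ℝ} {s : Set ℝ}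
    (H : IsSolitonOn m lam h p s) (hs : IsOpen s) (hh : EqOn h' h s) (hp : EqOn p' p s) :
    IsSolitonOn m lam h' p' s := by
  intro r hr
  obtain ⟨h1, h2, h3⟩ := H r hr
  rw [← hh hr] at h1
  rw [← hp hr] at h2
  rw [← hh hr, ← hp hr] at h3
  exact ⟨h1, h2.congr_of_eventuallyEq (hh.eventuallyEq_of_mem (hs.mem_nhds hr)),
    h3.congr_of_eventuallyEq (hp.eventuallyEq_of_mem (hs.mem_nhds hr))⟩

/-- The soliton equation for `(log h, h_r / h)`; the parameter is `r⁻¹`. -/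
def logField (m lam : ℝ) (z : ℝ × (ℝ × ℝ)) : ℝ × ℝ :=
  (z.2.2, -z.2.2 ^ 2 / 2 + m * z.1 ^ 2 * (1 - Real.exp (-z.2.1)) / 2
    - (lam + m * z.1) * z.2.2 * Real.exp (-z.2.1) / 2)

theorem contDiff_logField (m lam : ℝ) : ContDiff ℝ 1 (logField m lam) := by
  unfold logField
  fun_prop

theorem continuousOn_inv_Ici {a : ℝ} (ha : 0 < a) :
    ContinuousOn (fun r : ℝ => r⁻¹) (Ici a) :=
  continuousOn_inv₀.mono fun _ hr => (ha.trans_le hr).ne'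

theorem IsSolitonOn.isIntegralCurveOnIcc_log {m lam : ℝ} {h p : ℝ → ℝ} {a b : ℝ} (ha : 0 < a)
    (H : IsSolitonOn m lam h p (Icc a b)) :
    IsIntegralCurveOnIcc (logField m lam) (fun r => r⁻¹) a b
      (fun r => (Real.log (h r), p r / h r)) := by
  intro r hr
  obtain ⟨h0, h1, h2⟩ := H r hr
  have hr0 : r ≠ 0 := (ha.trans_le hr.1).ne'
  have h0' := h0.ne'
  refine HasDerivAt.hasDerivWithinAt ?_
  have h3 := (h1.log h0').prodMk (h2.div h1 h0')
  refine h3.congr_deriv ?_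
  simp only [logField, Real.exp_neg, Real.exp_log h0, solitonAccel, Prod.mk.injEq, true_and]
  field_simp
  ring

theorem IsIntegralCurveOnIcc.isSolitonOn_exp {m lam : ℝ} {y : ℝ → ℝ × ℝ} {a b : ℝ} (ha : 0 < a)
    (H : IsIntegralCurveOnIcc (logField m lam) (fun r => r⁻¹) a b y) :
    IsSolitonOn m lam (fun r => Real.exp (y r).1) (fun r => (y r).2 * Real.exp (y r).1)
      (Ioo a b) := by
  intro r hr
  have hr0 : r ≠ 0 := (ha.trans hr.1).ne'
  have h1 := H.hasDerivAt hr
  have hL : HasDerivAt (fun r => (y r).1) (y r).2 r := by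
    exact hasDerivAt_fst h1
  have hv := hasDerivAt_snd h1
  refine ⟨Real.exp_pos _, ?_, ?_⟩
  · exact hL.exp.congr_deriv (mul_comm _ _)
  · refine (hv.mul hL.exp).congr_deriv ?_
    have he := Real.exp_pos (y r).1
    simp only [logField, Real.exp_neg, solitonAccel]
    field_simp
    ring

theorem IsSolitonOn.eqOn {m lam : ℝ} {h p h' p' : ℝ → ℝ} {a b : ℝ} (ha : 0 < a)
    (H : IsSolitonOn m lam h p (Icc a b)) (H' : IsSolitonOn m lam h' p' (Icc a b))
    (hh : h a = h' a) (hp : p a = p' a) : EqOn h h' (Icc a b) := by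
  intro r hr
  have h1 := (H.isIntegralCurveOnIcc_log ha).eqOn (contDiff_logField m lam)
    ((continuousOn_inv_Ici ha).mono Icc_subset_Ici_self) (H'.isIntegralCurveOnIcc_log ha)
    (by simp [hh, hp]) hr
  have h2 : Real.log (h r) = Real.log (h' r) := congrArg Prod.fst h1
  exact Real.log_injOn_pos (H r hr).1 (H' r hr).1 h2

/-- A priori bound for `(log h, h_r / h)` on bounded intervals. -/
theorem logField_apriori {m lam a T : ℝ} (hm : 0 < m) (hlam : 0 ≤ lam) (ha : 0 < a)
    (haT : a ≤ T) (y₀ : ℝ × ℝ) :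
    ∃ R, ∀ d ∈ Icc a T, ∀ y : ℝ → ℝ × ℝ, y a = y₀ →
      IsIntegralCurveOnIcc (logField m lam) (fun r => r⁻¹) a d y → ‖y d‖ ≤ R := by
  -- With L = log h and v = h_r / h: `K` bounds v above, `M` and `-M'` bound L, and `-N` bounds h_r
  -- below. The `+ 1` in `K` ensures `K ^ 2 > m * a⁻¹ ^ 2`.
  obtain ⟨K, hKdef⟩ : ∃ K, K = |y₀.2| + m * (a⁻¹) ^ 2 + 1 := ⟨_, rfl⟩
  obtain ⟨M, hMdef⟩ : ∃ M, M = |y₀.1| + K * (T - a) := ⟨_, rfl⟩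
  obtain ⟨Q₀, hQdef⟩ : ∃ Q₀, Q₀ = y₀.2 * Real.exp y₀.1 + (lam + m * a⁻¹) * y₀.1 / 2 := ⟨_, rfl⟩
  obtain ⟨M', hM'def⟩ : ∃ M', M' = 2 * (|Q₀| + K * Real.exp M) * T / m := ⟨_, rfl⟩
  obtain ⟨N, hNdef⟩ : ∃ N, N = |Q₀| + (lam + m * a⁻¹) * M / 2 := ⟨_, rfl⟩
  have hs : 0 ≤ m * (a⁻¹) ^ 2 := by positivity
  have hK1 : 1 ≤ K := by linarith [abs_nonneg y₀.2]
  have hK2 : m * (a⁻¹) ^ 2 < K ^ 2 := by nlinarith [abs_nonneg y₀.2]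
  have hM0 : 0 ≤ M := by
    rw [hMdef]; have := sub_nonneg.2 haT; positivity
  refine ⟨max (max M M') (max K (N * Real.exp M')), fun d hd y hy0 hy => ?_⟩
  have hT0 : 0 < T := ha.trans_le haT
  have hd0 : 0 < d := ha.trans_le hd.1
  have hcont := hy.continuousOn
  have hc1 : ContinuousOn (fun t => (y t).1) (Icc a d) := continuous_fst.comp_continuousOn hcont
  have hc2 : ContinuousOn (fun t => (y t).2) (Icc a d) := continuous_snd.comp_continuousOn hcont
  have hd1 : ∀ x ∈ Ico a d, HasDerivWithinAt (fun t => (y t).1) (y x).2 (Ici x) x := fun x hx => by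
    exact hasDerivWithinAt_fst (hy.hasDerivWithinAt_Ici hx)
  have hd2 : ∀ x ∈ Ico a d, HasDerivWithinAt (fun t => (y t).2)
      (logField m lam (x⁻¹, y x)).2 (Ici x) x := fun x hx => by
    exact hasDerivWithinAt_snd (hy.hasDerivWithinAt_Ici hx)
  have hinv : ∀ x ∈ Icc a d, 0 < x⁻¹ ∧ x⁻¹ ≤ a⁻¹ := fun x hx =>
    ⟨inv_pos.2 (ha.trans_le hx.1), inv_anti₀ ha hx.1⟩
  -- Barrier argument: where v = `K`, the term -v²/2 dominates m r⁻²/2 and the remaining terms are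
  -- nonpositive, so v' < 0.
  have hvK : ∀ x ∈ Icc a d, (y x).2 ≤ K := by
    refine image_le_of_deriv_right_lt_deriv_boundary (B := fun _ => K) (B' := fun _ => 0)
      hc2 hd2 ?_ (fun x => hasDerivAt_const x K) ?_
    · simp only [hy0, hKdef]
      linarith [le_abs_self y₀.2]
    · intro x hx hxK
      obtain ⟨hx0, hxa⟩ := hinv x (Ico_subset_Icc_self hx)
      simp only [logField]
      rw [hxK]
      have he := Real.exp_pos (-(y x).1)
      have h1 : m * (x⁻¹) ^ 2 ≤ m * (a⁻¹) ^ 2 := by gcongr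
      have h2 : 0 ≤ m * (x⁻¹) ^ 2 * Real.exp (-(y x).1) := by positivity
      have h3 : 0 ≤ (lam + m * x⁻¹) * K * Real.exp (-(y x).1) := by positivity
      nlinarith
  have hLM : ∀ x ∈ Icc a d, (y x).1 ≤ M := by
    intro x hx
    have h1 : (y x).1 ≤ y₀.1 + K * (x - a) := by
      refine image_le_of_deriv_right_le_deriv_boundary (B := fun x => y₀.1 + K * (x - a))
        (B' := fun _ => K) hc1 hd1 (by simp [hy0]) (by fun_prop) (fun x _ => ?_)
        (fun x hx => hvK x (Ico_subset_Icc_self hx)) hx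
      have := ((hasDerivAt_id x).sub_const a).const_mul K |>.const_add y₀.1
      simpa using this.hasDerivWithinAt
    have h2 : K * (x - a) ≤ K * (T - a) := by
      have := hx.2.trans hd.2
      gcongr
    rw [hMdef]
    linarith [le_abs_self y₀.1]
  -- The quantity Q = h_r + (λ + m/r) log h / 2 is nondecreasing: its derivative is h v²/2 + m r⁻²
  -- (e^L - 1 - L)/2, nonnegative by e^L ≥ 1 + L.
  have hQ : -((y d).2 * Real.exp (y d).1 + (lam + m * d⁻¹) * (y d).1 / 2) ≤ -Q₀ := by
    refine image_le_of_deriv_right_le_deriv_boundary (B := fun _ => -Q₀) (B' := fun _ => 0)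
      (f := fun x => -((y x).2 * Real.exp (y x).1 + (lam + m * x⁻¹) * (y x).1 / 2))
      (f' := fun x => -(Real.exp (y x).1 * (y x).2 ^ 2 / 2
        + m * (x⁻¹) ^ 2 * (Real.exp (y x).1 - 1 - (y x).1) / 2))
      ?_ ?_ (by simp [hy0, hQdef]) continuousOn_const
      (fun x _ => hasDerivWithinAt_const x _ _) ?_ (right_mem_Icc.2 hd.1)
    · have hci : ContinuousOn (fun r : ℝ => r⁻¹) (Icc a d) :=
        (continuousOn_inv_Ici ha).mono Icc_subset_Ici_self
      fun_prop
    · intro x hx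
      have hx0 : x ≠ 0 := (ha.trans_le hx.1).ne'
      have h1 := (hd2 x hx).mul (hd1 x hx).exp
      have h2 : HasDerivWithinAt (fun r : ℝ => r⁻¹) (-(x ^ 2)⁻¹) (Ici x) x :=
        (hasDerivAt_inv hx0).hasDerivWithinAt
      have h3 := (((h2.const_mul m).const_add lam).mul (hd1 x hx)).div_const 2
      refine (h1.add h3).neg.congr_deriv ?_
      have he := Real.exp_pos (y x).1
      simp only [logField, Real.exp_neg]
      field_simp
      ring
    · intro x hx
      have h1 := Real.add_one_le_exp (y x).1
      have h2 : 0 ≤ Real.exp (y x).1 - 1 - (y x).1 := by linarith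
      have h3 : 0 ≤ Real.exp (y x).1 * (y x).2 ^ 2 / 2
        + m * (x⁻¹) ^ 2 * (Real.exp (y x).1 - 1 - (y x).1) / 2 := by positivity
      linarith
  have hdd := right_mem_Icc.2 hd.1
  have hv := hvK d hdd
  have hL := hLM d hdd
  obtain ⟨hi0, hia⟩ := hinv d hdd
  have hP : (y d).2 * Real.exp (y d).1 ≤ K * Real.exp M := by gcongr
  -- Since h_r is bounded above, a very negative log h would push Q below its initial value; so h
  -- cannot collapse to 0.
  have hLlow : -M' ≤ (y d).1 := by
    by_contra! hcon
    have hM'0 : 0 ≤ M' := by rw [hM'def]; positivity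
    have h1 : (lam + m * d⁻¹) * (y d).1 ≤ m * T⁻¹ * (y d).1 := by
      have : T⁻¹ ≤ d⁻¹ := inv_anti₀ hd0 hd.2
      have : m * T⁻¹ ≤ lam + m * d⁻¹ := by nlinarith
      nlinarith
    have h2 : m * T⁻¹ * (y d).1 < m * T⁻¹ * (-M') := by gcongr
    have h3 : m * T⁻¹ * (-M') = -(2 * (|Q₀| + K * Real.exp M)) := by
      rw [hM'def]; field_simp
    linarith [neg_abs_le Q₀]
  have hvlow : -(N * Real.exp M') ≤ (y d).2 := by
    have h1 : (lam + m * d⁻¹) * (y d).1 ≤ (lam + m * a⁻¹) * M :=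
      (mul_le_mul_of_nonneg_left hL (by positivity)).trans (by gcongr)
    have h2 : -N ≤ (y d).2 * Real.exp (y d).1 := by linarith [neg_abs_le Q₀]
    have hN : 0 ≤ N := by rw [hNdef]; positivity
    have h3 : (y d).2 = (y d).2 * Real.exp (y d).1 * Real.exp (-(y d).1) := by
      rw [mul_assoc, ← Real.exp_add]; simp
    have h4 : Real.exp (-(y d).1) ≤ Real.exp M' := Real.exp_le_exp.2 (by linarith)
    rw [h3]
    have h5 := Real.exp_pos (-(y d).1)
    nlinarith
  rw [Prod.norm_def, Real.norm_eq_abs, Real.norm_eq_abs]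
  refine max_le_max ?_ ?_
  · rw [abs_le']; exact ⟨hL.trans (le_max_left _ _), le_max_of_le_right (by linarith)⟩
  · rw [abs_le']; exact ⟨hv.trans (le_max_left _ _), le_max_of_le_right (by linarith)⟩

/-- A solution of the soliton equation on `(0, b)` extends to `(0, ∞)`. -/
theorem IsSolitonOn.exists_extension {m lam : ℝ} (hm : 0 < m) (hlam : 0 ≤ lam) {h p : ℝ → ℝ}
    {b : ℝ} (hb : 0 < b) (H : IsSolitonOn m lam h p (Ioo 0 b)) :
    ∃ h' p' : ℝ → ℝ, IsSolitonOn m lam h' p' (Ioi 0) ∧ EqOn h' h (Ioo 0 b) ∧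
      EqOn p' p (Ioo 0 b) := by
  -- Restarting at an interior point leaves an overlap `[a, b)` on which uniqueness identifies the
  -- two pieces, so the glued functions are differentiable at `a`.
  obtain ⟨a, ha0, hab⟩ := exists_between hb
  obtain ⟨y, hy0, hy⟩ := exists_isIntegralCurveOnIcc_forall (contDiff_logField m lam)
    (continuousOn_inv_Ici ha0) (y₀ := (Real.log (h a), p a / h a)) (fun T hT => by
      obtain ⟨R, hR⟩ := logField_apriori hm hlam ha0 hT (Real.log (h a), p a / h a)
      exact exists_isIntegralCurveOnIcc_of_bound (contDiff_logField m lam) hT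
        ((continuousOn_inv_Ici ha0).mono Icc_subset_Ici_self) _ R hR)
  have hEq : ∀ r, a ≤ r → r < b → y r = (Real.log (h r), p r / h r) := by
    intro r har hrb
    exact (hy r har).eqOn (contDiff_logField m lam)
      ((continuousOn_inv_Ici ha0).mono Icc_subset_Ici_self)
      ((H.mono fun x hx => ⟨ha0.trans_le hx.1, hx.2.trans_lt hrb⟩).isIntegralCurveOnIcc_log ha0)
      hy0 (right_mem_Icc.2 har)
  have hE1 : EqOn (fun r => if r ≤ a then h r else Real.exp (y r).1) h (Ioo 0 b) := by
    intro r hr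
    by_cases hra : r ≤ a
    · simp [hra]
    · simp only [hra, if_false]
      rw [hEq r (not_le.1 hra).le hr.2, Real.exp_log (H r hr).1]
  have hE2 : EqOn (fun r => if r ≤ a then p r else (y r).2 * Real.exp (y r).1) p (Ioo 0 b) := by
    intro r hr
    by_cases hra : r ≤ a
    · simp [hra]
    · simp only [hra, if_false]
      rw [hEq r (not_le.1 hra).le hr.2, Real.exp_log (H r hr).1]
      exact div_mul_cancel₀ _ (H r hr).1.ne'
  refine ⟨fun r => if r ≤ a then h r else Real.exp (y r).1,
    fun r => if r ≤ a then p r else (y r).2 * Real.exp (y r).1, fun r hr => ?_, hE1, hE2⟩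
  rcases lt_or_ge r b with hrb | hrb
  · exact H.congr isOpen_Ioo hE1 hE2 r ⟨hr, hrb⟩
  · have h1 := (hy (r + 1) (by linarith)).isSolitonOn_exp ha0
    refine h1.congr (h' := fun r => if r ≤ a then h r else Real.exp (y r).1)
      (p' := fun r => if r ≤ a then p r else (y r).2 * Real.exp (y r).1) isOpen_Ioo
      (fun x hx => ?_) (fun x hx => ?_) r ⟨by linarith, by linarith⟩
    · simp [hx.1]
    · simp [hx.1]

/-! ### Regularisation at r = 0: the profile system for (H, B). -/

/-- `α h + r h_r` written in terms of the remainder `B`. -/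
def fluxTerm (α lam c₂ r B : ℝ) : ℝ := -c₂ + α * lam / 2 * (r * Real.log r) + r * B

/-- The soliton equation for `H = r ^ α h` and `B = h_r + (α h + c₂) / r - (α λ / 2) log r`. -/
def IsProfileOn (α lam m c₂ : ℝ) (H B : ℝ → ℝ) (s : Set ℝ) : Prop :=
  ∀ r ∈ s, 0 < H r ∧ HasDerivAt H (r ^ α / r * fluxTerm α lam c₂ r (B r)) r ∧
    HasDerivAt B (r ^ α / r ^ 2 * (fluxTerm α lam c₂ r (B r) *
      (fluxTerm α lam c₂ r (B r) - lam * r - m)) / (2 * H r)) r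

theorem hasDerivAt_rpow_div {r : ℝ} (hr : 0 < r) (s : ℝ) :
    HasDerivAt (fun r : ℝ => r ^ s) (s * (r ^ s / r)) r := by
  refine (Real.hasDerivAt_rpow_const (Or.inl hr.ne')).congr_deriv ?_
  rw [Real.rpow_sub_one hr.ne']

/-- In the derivative of B the terms linear in h cancel exactly because m = α² + 2α, the multiples
of r⁻² because of the value of c₂, and the λ/r term because of the logarithm in B. -/
theorem IsSolitonOn.isProfileOn {α lam m c₂ : ℝ} (hm : m = α ^ 2 + 2 * α)
    (hc₂ : c₂ = m * (α - 1) / 2) {h p : ℝ → ℝ} {s : Set ℝ} (hs : s ⊆ Ioi 0)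
    (H : IsSolitonOn m lam h p s) :
    IsProfileOn α lam m c₂ (fun r => r ^ α * h r)
      (fun r => p r + (α * h r + c₂) / r - α * lam / 2 * Real.log r) s := by
  intro r hr
  obtain ⟨h0, h1, h2⟩ := H r hr
  have hr0 : 0 < r := hs hr
  have hr0' := hr0.ne'
  have hX : 0 < r ^ α := Real.rpow_pos_of_pos hr0 α
  have hq : fluxTerm α lam c₂ r (p r + (α * h r + c₂) / r - α * lam / 2 * Real.log r)
      = α * h r + r * p r := by
    unfold fluxTerm; field_simp; ring
  rw [hq]
  refine ⟨mul_pos hX h0, ?_, ?_⟩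
  · refine ((hasDerivAt_rpow_div hr0 α).mul h1).congr_deriv ?_
    field_simp
  · refine ((h2.add (((h1.const_mul α).add_const c₂).div (hasDerivAt_id r) hr0')).sub
      ((Real.hasDerivAt_log hr0').const_mul (α * lam / 2))).congr_deriv ?_
    simp only [solitonAccel, id]
    rw [hc₂, hm]
    field_simp
    ring

theorem IsProfileOn.isSolitonOn {α lam m c₂ : ℝ} (hm : m = α ^ 2 + 2 * α)
    (hc₂ : c₂ = m * (α - 1) / 2) {H B : ℝ → ℝ} {s : Set ℝ} (hs : s ⊆ Ioi 0)
    (hHB : IsProfileOn α lam m c₂ H B s) :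
    IsSolitonOn m lam (fun r => H r / r ^ α)
      (fun r => B r - (α * (H r / r ^ α) + c₂) / r + α * lam / 2 * Real.log r) s := by
  intro r hr
  obtain ⟨h0, h1, h2⟩ := hHB r hr
  have hr0 : 0 < r := hs hr
  have hr0' := hr0.ne'
  have hX : 0 < r ^ α := Real.rpow_pos_of_pos hr0 α
  have hh : HasDerivAt (fun r => H r / r ^ α)
      (B r - (α * (H r / r ^ α) + c₂) / r + α * lam / 2 * Real.log r) r := by
    refine (h1.div (hasDerivAt_rpow_div hr0 α) hX.ne').congr_deriv ?_
    unfold fluxTerm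
    field_simp
    ring
  refine ⟨div_pos h0 hX, hh, ?_⟩
  refine ((h2.sub (((hh.const_mul α).add_const c₂).div (hasDerivAt_id r) hr0')).add
      ((Real.hasDerivAt_log hr0').const_mul (α * lam / 2))).congr_deriv ?_
  simp only [solitonAccel, id, fluxTerm]
  rw [hc₂, hm]
  field_simp
  ring

theorem IsProfileOn.mono {α lam m c₂ : ℝ} {H B : ℝ → ℝ} {s t : Set ℝ}
    (h : IsProfileOn α lam m c₂ H B s) (hts : t ⊆ s) : IsProfileOn α lam m c₂ H B t :=
  fun r hr => h r (hts hr)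

/-- The equation for `(log H, B)` in the variable `ρ = r ^ κ`, `κ = α - 1`;
the parameters are `r` and `r log r`. -/
def profileField (α lam m c₂ : ℝ) (z : (ℝ × ℝ) × (ℝ × ℝ)) : ℝ × ℝ :=
  (z.1.1 * (-c₂ + α * lam / 2 * z.1.2 + z.1.1 * z.2.2) * Real.exp (-z.2.1) / (α - 1),
    (-c₂ + α * lam / 2 * z.1.2 + z.1.1 * z.2.2) *
      ((-c₂ + α * lam / 2 * z.1.2 + z.1.1 * z.2.2) - lam * z.1.1 - m) *
      Real.exp (-z.2.1) / (2 * (α - 1)))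

theorem contDiff_profileField (α lam m c₂ : ℝ) : ContDiff ℝ 1 (profileField α lam m c₂) := by
  unfold profileField
  fun_prop

/-- The parameters `r` and `r log r` in terms of `ρ = r ^ κ`. -/
def profileParam (κ ρ : ℝ) : ℝ × ℝ := (ρ ^ κ⁻¹, ρ ^ κ⁻¹ * Real.log (ρ ^ κ⁻¹))

theorem continuous_profileParam {κ : ℝ} (hκ : 0 < κ) : Continuous (profileParam κ) := by
  have h : Continuous fun ρ : ℝ => ρ ^ κ⁻¹ := Real.continuous_rpow_const (inv_nonneg.2 hκ.le)
  exact h.prodMk (Real.continuous_mul_log.comp h)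

theorem profileParam_rpow {κ r : ℝ} (hκ : 0 < κ) (hr : 0 ≤ r) :
    profileParam κ (r ^ κ) = (r, r * Real.log r) := by
  simp [profileParam, Real.rpow_rpow_inv hr hκ.ne']

theorem profileParam_zero {κ : ℝ} (hκ : 0 < κ) : profileParam κ 0 = (0, 0) := by
  simp [profileParam, Real.zero_rpow (inv_pos.2 hκ).ne']

/-- Chain rule with dρ = (α - 1) r^(α-2) dr, which absorbs the singular weight. -/
theorem IsIntegralCurveOnIcc.isProfileOn {α lam m c₂ d : ℝ} (hα : 1 < α) (hd : 0 ≤ d)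
    {y : ℝ → ℝ × ℝ}
    (hy : IsIntegralCurveOnIcc (profileField α lam m c₂) (profileParam (α - 1)) 0 d y) :
    IsProfileOn α lam m c₂ (fun r => Real.exp (y (r ^ (α - 1))).1)
      (fun r => (y (r ^ (α - 1))).2) (Ioo 0 (d ^ (α - 1)⁻¹)) := by
  intro r hr
  have hκ : 0 < α - 1 := sub_pos.2 hα
  have hr0 : 0 < r := hr.1
  have hmem : r ^ (α - 1) ∈ Ioo 0 d :=
    ⟨Real.rpow_pos_of_pos hr0 _, by
      have := Real.rpow_lt_rpow hr0.le hr.2 hκ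
      rwa [Real.rpow_inv_rpow hd hκ.ne'] at this⟩
  have h1 := (hy.hasDerivAt hmem).scomp r (hasDerivAt_rpow_div hr0 (α - 1))
  rw [profileParam_rpow hκ hr0.le] at h1
  have hX : r ^ (α - 1) = r ^ α / r := Real.rpow_sub_one hr0.ne' α
  have hL := hasDerivAt_fst h1
  have hB := hasDerivAt_snd h1
  refine ⟨Real.exp_pos _, ?_, ?_⟩
  · refine hL.exp.congr_deriv ?_
    simp only [profileField, Real.exp_neg, Function.comp, fluxTerm, Prod.smul_fst, smul_eq_mul]
    have := Real.exp_pos (y (r ^ (α - 1))).1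
    have h5 : r ^ α = r ^ (α - 1) * r := by rw [hX]; field_simp
    rw [h5]
    field_simp
  · refine hB.congr_deriv ?_
    simp only [profileField, Real.exp_neg, fluxTerm, Prod.smul_snd, smul_eq_mul]
    have := Real.exp_pos (y (r ^ (α - 1))).1
    have h5 : r ^ α = r ^ (α - 1) * r := by rw [hX]; field_simp
    rw [h5]
    field_simp

section

variable {P E : Type*} [NormedAddCommGroup E] [NormedSpace ℝ E] [TopologicalSpace P]

/-- A curve continuous at the left endpoint which follows a continuous field to the right of it
is an integral curve up to the endpoint. -/
theorem isIntegralCurveOnIcc_of_hasDerivAt {G : P × E → E} (hG : Continuous G) {c : ℝ → P}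
    (hc : Continuous c) {a b d : ℝ} (hdb : d < b) {y : ℝ → E}
    (hya : ContinuousWithinAt y (Ioi a) a)
    (hy : ∀ t ∈ Ioo a b, HasDerivAt y (G (c t, y t)) t) : IsIntegralCurveOnIcc G c a d y := by
  intro t ht
  rcases ht.1.eq_or_lt with rfl | hat
  · have hab : a < b := ht.2.trans_lt hdb
    have hmem : Ioo a b ∈ 𝓝[>] a := Ioo_mem_nhdsGT hab
    -- At the endpoint the one-sided derivative exists because the derivatives to its right
    -- converge, by continuity of the field along the curve.
    refine (hasDerivWithinAt_Ici_of_tendsto_deriv (s := Ioo a b)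
      (fun t ht => (hy t ht).differentiableAt.differentiableWithinAt)
      (hya.mono Ioo_subset_Ioi_self) hmem ?_).mono Icc_subset_Ici_self
    have h1 : Tendsto (fun t => G (c t, y t)) (𝓝[>] a) (𝓝 (G (c a, y a))) :=
      (hG.tendsto _).comp (((hc.tendsto a).mono_left nhdsWithin_le_nhds).prodMk_nhds hya)
    exact h1.congr' (eventually_of_mem hmem fun t ht => (hy t ht).deriv.symm)
  · exact (hy t ⟨hat, ht.2.trans_lt hdb⟩).hasDerivWithinAt

end

/-- The curve in `ρ = r ^ κ` described by `(log H, B)`, with prescribed value at `0`. -/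
def profileCurve (κ : ℝ) (y₀ : ℝ × ℝ) (H B : ℝ → ℝ) (ρ : ℝ) : ℝ × ℝ :=
  if ρ ≤ 0 then y₀ else (Real.log (H (ρ ^ κ⁻¹)), B (ρ ^ κ⁻¹))

/-- Limits of H and B at 0 are all that is needed to make a solution an integral curve up to ρ = 0,
where uniqueness can be applied. -/
theorem IsProfileOn.isIntegralCurveOnIcc {α lam m c₂ b d c₀ c₁ : ℝ} (hα : 1 < α) (hc₀ : 0 < c₀)
    {H B : ℝ → ℝ} (hb : 0 < b) (hHB : IsProfileOn α lam m c₂ H B (Ioo 0 b))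
    (hH : Tendsto H (𝓝[>] 0) (𝓝 c₀)) (hB : Tendsto B (𝓝[>] 0) (𝓝 c₁))
    (hd : d < b ^ (α - 1)) :
    IsIntegralCurveOnIcc (profileField α lam m c₂) (profileParam (α - 1)) 0 d
      (profileCurve (α - 1) (Real.log c₀, c₁) H B) := by
  have hκ : 0 < α - 1 := sub_pos.2 hα
  have hpos : ∀ ρ : ℝ, 0 < ρ → profileCurve (α - 1) (Real.log c₀, c₁) H B ρ =
      (Real.log (H (ρ ^ (α - 1)⁻¹)), B (ρ ^ (α - 1)⁻¹)) := fun ρ hρ => by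
    simp [profileCurve, hρ]
  refine isIntegralCurveOnIcc_of_hasDerivAt (contDiff_profileField α lam m c₂).continuous
    (continuous_profileParam hκ) hd ?_ ?_
  · have h1 : Tendsto (fun ρ : ℝ => ρ ^ (α - 1)⁻¹) (𝓝[>] 0) (𝓝[>] 0) := by
      refine tendsto_nhdsWithin_iff.2 ⟨?_, eventually_of_mem self_mem_nhdsWithin fun ρ hρ =>
        Real.rpow_pos_of_pos hρ _⟩
      have := (Real.continuous_rpow_const (inv_nonneg.2 hκ.le)).tendsto (0 : ℝ)
      rw [Real.zero_rpow (inv_pos.2 hκ).ne'] at this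
      exact this.mono_left nhdsWithin_le_nhds
    have h2 : Tendsto (fun ρ : ℝ => (Real.log (H (ρ ^ (α - 1)⁻¹)), B (ρ ^ (α - 1)⁻¹)))
        (𝓝[>] 0) (𝓝 (Real.log c₀, c₁)) :=
      ((hH.comp h1).log hc₀.ne').prodMk_nhds (hB.comp h1)
    have h3 : profileCurve (α - 1) (Real.log c₀, c₁) H B 0 = (Real.log c₀, c₁) := by
      simp [profileCurve]
    unfold ContinuousWithinAt
    rw [h3]
    exact h2.congr' (eventually_of_mem self_mem_nhdsWithin fun ρ hρ => (hpos ρ hρ).symm)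
  · intro ρ hρ
    have hρ0 : 0 < ρ := hρ.1
    obtain ⟨r, hr⟩ : ∃ r, r = ρ ^ (α - 1)⁻¹ := ⟨_, rfl⟩
    have hr0 : 0 < r := hr ▸ Real.rpow_pos_of_pos hρ0 _
    have hρr : ρ = r ^ (α - 1) := by rw [hr, Real.rpow_inv_rpow hρ0.le hκ.ne']
    have hrb : r < b := by
      have := hρ.2
      rw [hρr] at this
      exact (Real.rpow_lt_rpow_iff hr0.le hb.le hκ).1 this
    obtain ⟨h0, h1, h2⟩ := hHB r ⟨hr0, hrb⟩
    have hX : r ^ (α - 1) = r ^ α / r := Real.rpow_sub_one hr0.ne' α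
    have hrho := hasDerivAt_rpow_div hρ0 (α - 1)⁻¹
    rw [hr] at h1 h2
    have h3 := ((h1.comp ρ hrho).log (hr ▸ h0).ne').prodMk (h2.comp ρ hrho)
    have h4 : HasDerivAt (profileCurve (α - 1) (Real.log c₀, c₁) H B) _ ρ :=
      h3.congr_of_eventuallyEq
        (eventually_of_mem (Ioi_mem_nhds hρ0) fun x hx => hpos x hx)
    refine h4.congr_deriv ?_
    rw [hpos ρ hρ0, ← hr]
    have hpar : profileParam (α - 1) ρ = (r, r * Real.log r) := by
      rw [hρr, profileParam_rpow hκ hr0.le]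
    rw [hpar]
    have hY := Real.rpow_pos_of_pos hr0 α
    simp only [profileField, Real.exp_neg, Real.exp_log h0, fluxTerm, Function.comp, ← hr]
    rw [hρr, hX]
    ext <;> simp only <;> field_simp

/-! ### Asymptotic expansion at 0. -/

/-- The expansion of `H = r ^ α h` up to order `r ^ (2 α)`, whose last coefficient is `E`. -/
def profileExpansion (α lam c₀ c₁ c₂ E r : ℝ) : ℝ :=
  c₀ - c₂ / α * r ^ α
    + (c₁ / (α + 1) - α * lam / (2 * (α + 1) ^ 2)) * r ^ (α + 1)
    + α * lam / (2 * α + 2) * r ^ (α + 1) * Real.log r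
    + E * r ^ (2 * α)

theorem rpow_add_one_eq_mul {r : ℝ} (hr : 0 < r) (α : ℝ) : r ^ (α + 1) = r ^ α * r := by
  rw [Real.rpow_add hr, Real.rpow_one]

theorem rpow_two_mul_eq_mul {r : ℝ} (hr : 0 < r) (α : ℝ) : r ^ (2 * α) = r ^ α * r ^ α := by
  rw [two_mul, Real.rpow_add hr]

theorem tendsto_rpow_nhdsGT_zero {s : ℝ} (hs : 0 < s) :
    Tendsto (fun r : ℝ => r ^ s) (𝓝[>] 0) (𝓝 0) := by
  have := (Real.continuous_rpow_const hs.le).tendsto (0 : ℝ)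
  rw [Real.zero_rpow hs.ne'] at this
  exact this.mono_left nhdsWithin_le_nhds

theorem tendsto_rpow_nhdsGT_nhdsGT {s : ℝ} (hs : 0 < s) :
    Tendsto (fun r : ℝ => r ^ s) (𝓝[>] 0) (𝓝[>] 0) :=
  tendsto_nhdsWithin_iff.2 ⟨tendsto_rpow_nhdsGT_zero hs,
    eventually_of_mem self_mem_nhdsWithin fun _ hr => Real.rpow_pos_of_pos hr _⟩

theorem tendsto_profileExpansion {α : ℝ} (hα : 0 < α) (lam c₀ c₁ c₂ E : ℝ) :
    Tendsto (profileExpansion α lam c₀ c₁ c₂ E) (𝓝[>] 0) (𝓝 c₀) := by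
  have h1 := tendsto_rpow_nhdsGT_zero hα
  have h2 := tendsto_rpow_nhdsGT_zero (show 0 < α + 1 by linarith)
  have h3 := tendsto_rpow_nhdsGT_zero (show 0 < 2 * α by linarith)
  have h4 : Tendsto (fun r : ℝ => r * Real.log r) (𝓝[>] 0) (𝓝 0) := by
    have := Real.continuous_mul_log.tendsto (0 : ℝ)
    rw [zero_mul] at this
    exact this.mono_left nhdsWithin_le_nhds
  have h5 : Tendsto (fun r : ℝ => α * lam / (2 * α + 2) * r ^ (α + 1) * Real.log r)
      (𝓝[>] 0) (𝓝 0) := by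
    have := (h1.mul h4).const_mul (α * lam / (2 * α + 2))
    rw [mul_zero, mul_zero] at this
    refine this.congr' (eventually_of_mem self_mem_nhdsWithin fun r hr => ?_)
    simp only
    rw [rpow_add_one_eq_mul hr]
    ring
  have := ((((h1.const_mul (c₂ / α)).const_sub c₀).add
    (h2.const_mul (c₁ / (α + 1) - α * lam / (2 * (α + 1) ^ 2)))).add h5).add (h3.const_mul E)
  change Tendsto (fun r => profileExpansion α lam c₀ c₁ c₂ E r) _ _
  simpa [profileExpansion] using this

theorem hasDerivAt_profileExpansion {α r : ℝ} (hα : 0 < α) (hr : 0 < r) (lam c₀ c₁ c₂ E : ℝ) :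
    HasDerivAt (profileExpansion α lam c₀ c₁ c₂ E)
      (r ^ α / r * fluxTerm α lam c₂ r c₁ + 2 * α * E * (r ^ (2 * α) / r)) r := by
  have h1 := (hasDerivAt_rpow_div hr α).const_mul (c₂ / α)
  have h2 := (hasDerivAt_rpow_div hr (α + 1))
  have h3 := (hasDerivAt_rpow_div hr (2 * α)).const_mul E
  have h4 := ((h2.const_mul (α * lam / (2 * α + 2))).mul (Real.hasDerivAt_log hr.ne'))
  refine ((((h1.const_sub c₀).add
    (h2.const_mul (c₁ / (α + 1) - α * lam / (2 * (α + 1) ^ 2)))).add h4).add h3).congr_deriv ?_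
  simp only [fluxTerm, rpow_add_one_eq_mul hr]
  have : α + 1 ≠ 0 := by positivity
  have : 2 * α + 2 ≠ 0 := by positivity
  field_simp
  ring

/-- The first four terms of the expansion are the integral of H_r with B frozen at c₁, so only B -
c₁ and the last term survive. -/
theorem IsProfileOn.hasDerivAt_sub_profileExpansion {α lam m c₀ c₁ c₂ r : ℝ} (E : ℝ) (hα : 0 < α)
    (hr : 0 < r) {H B : ℝ → ℝ} {s : Set ℝ} (hHB : IsProfileOn α lam m c₂ H B s) (hrs : r ∈ s) :
    HasDerivAt (fun r => H r - profileExpansion α lam c₀ c₁ c₂ E r)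
      (r ^ α * (B r - c₁) - 2 * α * E * (r ^ (2 * α) / r)) r := by
  refine ((hHB r hrs).2.1.sub (hasDerivAt_profileExpansion hα hr lam c₀ c₁ c₂ E)).congr_deriv ?_
  unfold fluxTerm
  field_simp
  ring

/-- First order behaviour of `B` in the variable `r ^ (α - 1)`. -/
theorem IsIntegralCurveOnIcc.tendsto_remainder {α lam m c₂ d c₀ c₁ : ℝ} (hα : 1 < α) (hd : 0 < d)
    (hc₀ : 0 < c₀) {y : ℝ → ℝ × ℝ} (hy0 : y 0 = (Real.log c₀, c₁))
    (hy : IsIntegralCurveOnIcc (profileField α lam m c₂) (profileParam (α - 1)) 0 d y) :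
    Tendsto (fun r => ((y (r ^ (α - 1))).2 - c₁) / r ^ (α - 1)) (𝓝[>] 0)
      (𝓝 (c₂ * (c₂ + m) / (2 * (α - 1) * c₀))) := by
  have hκ : 0 < α - 1 := sub_pos.2 hα
  have h1 := hasDerivWithinAt_snd (hy.hasDerivWithinAt_Ici (left_mem_Ico.2 hd))
  rw [hasDerivWithinAt_iff_tendsto_slope, Ici_sdiff_left] at h1
  have h2 := h1.comp (tendsto_rpow_nhdsGT_nhdsGT hκ)
  rw [profileParam_zero hκ, hy0] at h2
  have hval : (profileField α lam m c₂ ((0, 0), (Real.log c₀, c₁))).2 =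
      c₂ * (c₂ + m) / (2 * (α - 1) * c₀) := by
    simp only [profileField, Real.exp_neg, Real.exp_log hc₀]
    field_simp
    ring
  rw [hval] at h2
  refine h2.congr fun r => ?_
  simp [slope_def_field, hy0]

theorem IsIntegralCurveOnIcc.tendsto_exp_fst {α lam m c₂ d c₀ c₁ : ℝ} (hα : 1 < α) (hd : 0 < d)
    (hc₀ : 0 < c₀) {y : ℝ → ℝ × ℝ} (hy0 : y 0 = (Real.log c₀, c₁))
    (hy : IsIntegralCurveOnIcc (profileField α lam m c₂) (profileParam (α - 1)) 0 d y) :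
    Tendsto (fun r => Real.exp (y (r ^ (α - 1))).1) (𝓝[>] 0) (𝓝 c₀) := by
  have hκ : 0 < α - 1 := sub_pos.2 hα
  have h1 : ContinuousWithinAt y (Ioi 0) 0 :=
    (hy.hasDerivWithinAt_Ici (left_mem_Ico.2 hd)).continuousWithinAt.mono Ioi_subset_Ici_self
  have h2 : Tendsto y (𝓝[>] 0) (𝓝 (y 0)) := h1
  have h3 := (continuous_fst.tendsto _).comp (h2.comp (tendsto_rpow_nhdsGT_nhdsGT hκ))
  rw [hy0] at h3
  have h4 := (Real.continuous_exp.tendsto _).comp h3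
  rw [Real.exp_log hc₀] at h4
  exact h4

/-- If `B = c₁ + E' r ^ (α - 1) + o(r ^ (α - 1))` then `H` has the expansion up to
`o(r ^ (2 α))`. -/
theorem IsProfileOn.tendsto_expansion {α lam m c₀ c₁ c₂ b E' : ℝ} (hα : 1 < α) (hb : 0 < b)
    {H B : ℝ → ℝ} (hHB : IsProfileOn α lam m c₂ H B (Ioo 0 b))
    (hH : Tendsto H (𝓝[>] 0) (𝓝 c₀))
    (hB : Tendsto (fun r => (B r - c₁) / r ^ (α - 1)) (𝓝[>] 0) (𝓝 E')) :
    Tendsto (fun r => (H r - profileExpansion α lam c₀ c₁ c₂ (E' / (2 * α)) r) / r ^ (2 * α))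
      (𝓝[>] 0) (𝓝 0) := by
  have hα0 : 0 < α := by linarith
  have hpos : ∀ᶠ r : ℝ in 𝓝[>] 0, 0 < r := self_mem_nhdsWithin
  -- The quotient of derivatives is ((B - c₁)/r^(α-1) - E')/(2α), which tends to 0; this is why the
  -- last coefficient is E'/(2α).
  refine HasDerivAt.lhopital_zero_nhdsGT
    (eventually_of_mem (Ioo_mem_nhdsGT hb) fun r hr =>
      hHB.hasDerivAt_sub_profileExpansion (E' / (2 * α)) hα0 hr.1 hr)
    (hpos.mono fun r hr => hasDerivAt_rpow_div hr (2 * α))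
    (hpos.mono fun r hr => ?_) ?_ (tendsto_rpow_nhdsGT_zero (by linarith)) ?_
  · have := Real.rpow_pos_of_pos hr (2 * α)
    positivity
  · simpa using hH.sub (tendsto_profileExpansion hα0 lam c₀ c₁ c₂ (E' / (2 * α)))
  · have h1 := (hB.sub_const E').div_const (2 * α)
    rw [sub_self, zero_div] at h1
    refine h1.congr' (hpos.mono fun r hr => ?_)
    have hX := Real.rpow_pos_of_pos hr α
    simp only [rpow_two_mul_eq_mul hr, Real.rpow_sub_one hr.ne']
    field_simp

/-! ### Recovering the limit of B from the expansion of H. -/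

/-- B_r may grow quadratically in B, and no bound on B is available. Passing to arctan B divides by
1 + B² and leaves a rate of order r^(α-2), integrable at 0. -/
theorem IsProfileOn.abs_arctan_sub_le {α lam m c₂ a b c K : ℝ} (hα : 1 < α) {H B : ℝ → ℝ}
    (ha : 0 < a) (hab : a ≤ b) (hHB : IsProfileOn α lam m c₂ H B (Icc a b)) (hc : 0 < c)
    (hH : ∀ r ∈ Icc a b, c ≤ H r)
    (hK : ∀ r ∈ Icc a b, |fluxTerm α lam c₂ r (B r) * (fluxTerm α lam c₂ r (B r) - lam * r - m)|
      ≤ K * (1 + B r ^ 2)) :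
    |Real.arctan (B b) - Real.arctan (B a)| ≤ K / (2 * c * (α - 1)) * b ^ (α - 1) := by
  have hκ : 0 < α - 1 := sub_pos.2 hα
  have hpos : ∀ r ∈ Icc a b, 0 < r := fun r hr => ha.trans_le hr.1
  have hK0 : 0 ≤ K := by
    have h1 := (abs_nonneg _).trans (hK a (left_mem_Icc.2 hab))
    by_contra! hcon
    nlinarith [sq_nonneg (B a)]
  have hA : ∀ r ∈ Icc a b, HasDerivAt (fun r => Real.arctan (B r) - Real.arctan (B a))
      (1 / (1 + B r ^ 2) * (r ^ α / r ^ 2 * (fluxTerm α lam c₂ r (B r) *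
      (fluxTerm α lam c₂ r (B r) - lam * r - m)) / (2 * H r))) r := fun r hr =>
    ((hHB r hr).2.2.arctan).sub_const _
  have hG : ∀ r ∈ Icc a b, HasDerivAt
      (fun r => K / (2 * c * (α - 1)) * (r ^ (α - 1) - a ^ (α - 1)))
      (K / (2 * c * (α - 1)) * ((α - 1) * (r ^ (α - 1) / r))) r := fun r hr =>
    ((hasDerivAt_rpow_div (hpos r hr) (α - 1)).sub_const _).const_mul _
  have h1 := image_norm_le_of_norm_deriv_right_le_deriv_boundary'
    (f := fun r => Real.arctan (B r) - Real.arctan (B a))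
    (fun r hr => (hA r hr).continuousAt.continuousWithinAt)
    (fun r hr => (hA r (Ico_subset_Icc_self hr)).hasDerivWithinAt)
    (B := fun r => K / (2 * c * (α - 1)) * (r ^ (α - 1) - a ^ (α - 1))) (by simp)
    (fun r hr => (hG r hr).continuousAt.continuousWithinAt)
    (fun r hr => (hG r (Ico_subset_Icc_self hr)).hasDerivWithinAt)
    (fun r hr => ?_) (right_mem_Icc.2 hab)
  · rw [Real.norm_eq_abs] at h1
    refine h1.trans ?_
    have h2 : 0 ≤ a ^ (α - 1) := Real.rpow_nonneg ha.le _
    have h3 : b ^ (α - 1) - a ^ (α - 1) ≤ b ^ (α - 1) := by linarith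
    gcongr
  · have hr' := Ico_subset_Icc_self hr
    have hr0 := hpos r hr'
    have hX := Real.rpow_pos_of_pos hr0 α
    have hB0 : 0 < 1 + B r ^ 2 := by positivity
    have hHc := hH r hr'
    have hH0 : 0 < H r := hc.trans_le hHc
    rw [Real.norm_eq_abs, abs_mul, abs_of_pos (one_div_pos.2 hB0), abs_div, abs_mul (r ^ α / r ^ 2),
      abs_of_pos (show 0 < 2 * H r by positivity), abs_of_pos (show 0 < r ^ α / r ^ 2 by positivity),
      Real.rpow_sub_one hr0.ne']
    calc 1 / (1 + B r ^ 2) * (r ^ α / r ^ 2 * |fluxTerm α lam c₂ r (B r) *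
          (fluxTerm α lam c₂ r (B r) - lam * r - m)| / (2 * H r))
        ≤ 1 / (1 + B r ^ 2) * (r ^ α / r ^ 2 * (K * (1 + B r ^ 2)) / (2 * c)) := by
          have := hK r hr'
          gcongr
      _ = K / (2 * c * (α - 1)) * ((α - 1) * (r ^ α / r / r)) := by
          field_simp

theorem abs_fluxTerm_mul_le {α lam m c₂ r : ℝ} (hr : 0 < r) (hr1 : r ≤ 1) (B : ℝ) :
    |fluxTerm α lam c₂ r B * (fluxTerm α lam c₂ r B - lam * r - m)| ≤
      (2 * (|c₂| + |α * lam / 2| + |lam| + |m|) ^ 2 + 2) * (1 + B ^ 2) := by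
  obtain ⟨A, hA⟩ : ∃ A, A = |c₂| + |α * lam / 2| + |lam| + |m| := ⟨_, rfl⟩
  have hlog : |r * Real.log r| ≤ 1 := by
    rw [mul_comm]; exact (Real.abs_log_mul_self_lt r hr hr1).le
  have h1 : |α * lam / 2 * (r * Real.log r)| ≤ |α * lam / 2| := by
    rw [abs_mul]; exact mul_le_of_le_one_right (abs_nonneg _) hlog
  have h2 : |r * B| ≤ |B| := by
    rw [abs_mul, abs_of_pos hr]; exact mul_le_of_le_one_left (abs_nonneg _) hr1
  have h3 : |lam * r| ≤ |lam| := by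
    rw [abs_mul, abs_of_pos hr]; exact mul_le_of_le_one_right (abs_nonneg _) hr1
  have hq : |fluxTerm α lam c₂ r B| ≤ |c₂| + |α * lam / 2| + |B| := by
    unfold fluxTerm
    refine (abs_add_three _ _ _).trans ?_
    rw [abs_neg]
    gcongr
  have hq1 : |fluxTerm α lam c₂ r B| ≤ A + |B| := by
    linarith [abs_nonneg lam, abs_nonneg m]
  have hq2 : |fluxTerm α lam c₂ r B - lam * r - m| ≤ A + |B| := by
    have h4 := abs_sub (fluxTerm α lam c₂ r B - lam * r) m
    have h5 := abs_sub (fluxTerm α lam c₂ r B) (lam * r)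
    linarith
  rw [abs_mul, ← hA]
  have hA0 : 0 ≤ A := by rw [hA]; positivity
  calc _ ≤ (A + |B|) * (A + |B|) := by gcongr
    _ ≤ _ := by nlinarith [sq_nonneg (A - |B|), sq_abs B, mul_nonneg (sq_nonneg A) (sq_nonneg B)]

/-- The expansion of `H` alone determines the limit of `B`. -/
theorem IsProfileOn.tendsto_remainder_of_expansion {α lam m c₀ c₁ c₂ b E : ℝ} (hα : 1 < α)
    (hc₀ : 0 < c₀) (hb : 0 < b) {H B : ℝ → ℝ} (hHB : IsProfileOn α lam m c₂ H B (Ioo 0 b))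
    (hH : Tendsto H (𝓝[>] 0) (𝓝 c₀))
    (hexp : Tendsto (fun r => (H r - profileExpansion α lam c₀ c₁ c₂ E r) / r ^ (2 * α))
      (𝓝[>] 0) (𝓝 0)) :
    Tendsto B (𝓝[>] 0) (𝓝 c₁) := by
  have hκ : 0 < α - 1 := sub_pos.2 hα
  have hα0 : 0 < α := by linarith
  obtain ⟨b', hb'0, hb'⟩ : ∃ b' > 0, ∀ r ∈ Ioo 0 b', c₀ / 2 ≤ H r := by
    have h1 : ∀ᶠ r in 𝓝[>] (0 : ℝ), c₀ / 2 < H r := hH.eventually (lt_mem_nhds (by linarith))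
    obtain ⟨u, hu, hsub⟩ := mem_nhdsGT_iff_exists_Ioo_subset.1 h1
    exact ⟨u, hu, fun r hr => (hsub hr : c₀ / 2 < H r).le⟩
  obtain ⟨D, hD⟩ : ∃ D : ℝ → ℝ, D = fun r => H r - profileExpansion α lam c₀ c₁ c₂ E r := ⟨_, rfl⟩
  obtain ⟨K, hKdef⟩ : ∃ K, K = 2 * (|c₂| + |α * lam / 2| + |lam| + |m|) ^ 2 + 2 := ⟨_, rfl⟩
  have hpos : ∀ᶠ r : ℝ in 𝓝[>] 0, 0 < r := self_mem_nhdsWithin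
  obtain ⟨δ, hδdef⟩ : ∃ δ, δ = min 1 (min b b') / 2 := ⟨_, rfl⟩
  have hδ0 : 0 < δ := by rw [hδdef]; positivity
  have hδ : ∀ r, r < δ → 2 * r < 1 ∧ 2 * r < b ∧ 2 * r < b' := by
    intro r hr
    have h1 : 2 * r < min 1 (min b b') := by rw [hδdef] at hr; linarith
    simpa [lt_min_iff] using h1
  -- The error D is o(r^(2α)), so its slope over [r, 2r] is o(r^(2α-1)); some s in between therefore
  -- has B(s) - c₁ = O(r^(α-1)).
  have hmvt : ∀ r ∈ Ioo 0 δ, ∃ s ∈ Ioo r (2 * r), s ^ α * (B s - c₁) -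
      2 * α * E * (s ^ (2 * α) / s) = (D (2 * r) - D r) / (2 * r - r) := by
    intro r hr
    obtain ⟨-, h2, -⟩ := hδ r hr.2
    have hd : ∀ x ∈ Icc r (2 * r), HasDerivAt D
        (x ^ α * (B x - c₁) - 2 * α * E * (x ^ (2 * α) / x)) x := fun x hx => by
      have hx0 : 0 < x := hr.1.trans_le hx.1
      rw [hD]
      exact hHB.hasDerivAt_sub_profileExpansion E hα0 hx0 ⟨hx0, hx.2.trans_lt h2⟩
    exact exists_hasDerivAt_eq_slope D _ (by linarith [hr.1])
      (fun x hx => (hd x hx).continuousAt.continuousWithinAt)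
      (fun x hx => hd x (Ioo_subset_Icc_self hx))
  choose! s hs hsB using hmvt
  have hmem : ∀ᶠ r : ℝ in 𝓝[>] 0, r ∈ Ioo 0 δ := Ioo_mem_nhdsGT hδ0
  have htwo : Tendsto (fun r : ℝ => 2 * r) (𝓝[>] 0) (𝓝[>] 0) := by
    refine tendsto_nhdsWithin_iff.2 ⟨?_, hpos.mono fun r hr => by simpa using hr⟩
    have := (continuous_const_mul (2 : ℝ)).tendsto 0
    rw [mul_zero] at this
    exact this.mono_left nhdsWithin_le_nhds
  have hBs : Tendsto (fun r => B (s r)) (𝓝[>] 0) (𝓝 c₁) := by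
    rw [tendsto_iff_norm_sub_tendsto_zero]
    have hbound : Tendsto (fun r : ℝ => |2 * α * E| * (2 * r) ^ (α - 1) +
        (2 ^ (2 * α) * |D (2 * r) / (2 * r) ^ (2 * α)| + |D r / r ^ (2 * α)|) * r ^ (α - 1))
        (𝓝[>] 0) (𝓝 0) := by
      have h0 := tendsto_rpow_nhdsGT_zero hκ
      have h1 := (h0.comp htwo).const_mul |2 * α * E|
      have h2 : Tendsto (fun r => D r / r ^ (2 * α)) (𝓝[>] 0) (𝓝 0) := by rw [hD]; exact hexp
      have h3 := ((h2.comp htwo).abs.const_mul ((2 : ℝ) ^ (2 * α))).add h2.abs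
      simpa using h1.add (h3.mul h0)
    refine squeeze_zero' (Eventually.of_forall fun r => norm_nonneg _) (hmem.mono fun r hr => ?_)
      hbound
    have hr0 := hr.1
    obtain ⟨hs1, hs2⟩ := hs r hr
    have hs0 : 0 < s r := hr0.trans hs1
    have hX := Real.rpow_pos_of_pos hs0 α
    have hY := Real.rpow_pos_of_pos hr0 α
    have hsplit : B (s r) - c₁ = 2 * α * E * s r ^ (α - 1) + (D (2 * r) - D r) / (r * s r ^ α) := by
      have h1 := hsB r hr
      have h2 : 2 * r - r = r := by ring
      rw [h2, rpow_two_mul_eq_mul hs0] at h1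
      rw [Real.rpow_sub_one hs0.ne']
      have h3 : D (2 * r) - D r = r * (s r ^ α * (B (s r) - c₁) -
          2 * α * E * (s r ^ α * s r ^ α / s r)) := by
        rw [h1]; field_simp
      rw [h3]
      field_simp
      ring
    rw [Real.norm_eq_abs, hsplit]
    refine (abs_add_le _ _).trans (add_le_add ?_ ?_)
    · rw [abs_mul, abs_of_pos (Real.rpow_pos_of_pos hs0 _)]
      gcongr
    · have h1 : 0 < (2 : ℝ) ^ (2 * α) := by positivity
      rw [abs_div, abs_of_pos (show 0 < r * s r ^ α by positivity), abs_div, abs_div,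
        abs_of_pos (Real.rpow_pos_of_pos (show 0 < 2 * r by linarith) (2 * α)),
        abs_of_pos (Real.rpow_pos_of_pos hr0 (2 * α)),
        Real.mul_rpow zero_le_two hr0.le, rpow_two_mul_eq_mul hr0, Real.rpow_sub_one hr0.ne']
      calc |D (2 * r) - D r| / (r * s r ^ α) ≤ (|D (2 * r)| + |D r|) / (r * r ^ α) := by
            gcongr
            exact abs_sub _ _
        _ = _ := by field_simp
  -- The arctan bound carries the information from the selected points s(r) to every r.
  have hcmp : ∀ᶠ r in 𝓝[>] (0 : ℝ), |Real.arctan (B (s r)) - Real.arctan (B r)| ≤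
      K / (2 * (c₀ / 2) * (α - 1)) * (2 * r) ^ (α - 1) := by
    refine hmem.mono fun r hr => ?_
    obtain ⟨hs1, hs2⟩ := hs r hr
    obtain ⟨h1, h2, h3⟩ := hδ r hr.2
    have hsub : Icc r (s r) ⊆ Ioo 0 (min 1 (min b b')) := fun x hx =>
      ⟨hr.1.trans_le hx.1, lt_min (by linarith [hx.2]) (lt_min (by linarith [hx.2])
        (by linarith [hx.2]))⟩
    have hx : ∀ x ∈ Icc r (s r), 0 < x ∧ x < 1 ∧ x < b ∧ x < b' := fun x hx => by
      simpa [lt_min_iff] using hsub hx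
    refine ((hHB.mono fun x h => ⟨(hx x h).1, (hx x h).2.2.1⟩).abs_arctan_sub_le hα hr.1 hs1.le
      (half_pos hc₀) (fun x h => hb' x ⟨(hx x h).1, (hx x h).2.2.2⟩) (K := K) fun x h => ?_).trans ?_
    · rw [hKdef]
      exact abs_fluxTerm_mul_le (hx x h).1 (hx x h).2.1.le _
    · have hK0 : 0 ≤ K := by rw [hKdef]; positivity
      have := hr.1.trans hs1
      gcongr
  have hdiff : Tendsto (fun r => Real.arctan (B (s r)) - Real.arctan (B r)) (𝓝[>] 0) (𝓝 0) := by
    refine squeeze_zero_norm' hcmp ?_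
    simpa using ((tendsto_rpow_nhdsGT_zero hκ).comp htwo).const_mul
      (K / (2 * (c₀ / 2) * (α - 1)))
  have harc : Tendsto (fun r => Real.arctan (B r)) (𝓝[>] 0) (𝓝 (Real.arctan c₁)) := by
    simpa using (((Real.continuous_arctan.tendsto c₁).comp hBs).sub hdiff)
  -- The limit arctan c₁ lies strictly inside (-π/2, π/2), where tan is continuous; in particular B
  -- cannot blow up.
  have htan := (Real.continuousAt_tan.2 (Real.cos_arctan_pos c₁).ne').tendsto.comp harc
  simpa [Function.comp_def, Real.tan_arctan] using htan

/-! ### Uniqueness and existence on (0, ∞). -/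

/-- The remainder `B = h_r + (α h + c₂) / r - (α λ / 2) log r` of a solution. -/
def remainder (α lam c₂ : ℝ) (h p : ℝ → ℝ) (r : ℝ) : ℝ :=
  p r + (α * h r + c₂) / r - α * lam / 2 * Real.log r

/-- Solutions on `(0, ∞)` are determined by the limits of `r ^ α h` and of the remainder. -/
theorem IsSolitonOn.eqOn_of_tendsto {α lam m c₂ c₀ c₁ : ℝ} (hα : 1 < α)
    (hm : m = α ^ 2 + 2 * α) (hc₂ : c₂ = m * (α - 1) / 2) (hc₀ : 0 < c₀) {h p h' p' : ℝ → ℝ}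
    (S : IsSolitonOn m lam h p (Ioi 0)) (S' : IsSolitonOn m lam h' p' (Ioi 0))
    (hH : Tendsto (fun r => r ^ α * h r) (𝓝[>] 0) (𝓝 c₀))
    (hH' : Tendsto (fun r => r ^ α * h' r) (𝓝[>] 0) (𝓝 c₀))
    (hB : Tendsto (remainder α lam c₂ h p) (𝓝[>] 0) (𝓝 c₁))
    (hB' : Tendsto (remainder α lam c₂ h' p') (𝓝[>] 0) (𝓝 c₁)) :
    EqOn h h' (Ioi 0) := by
  have hκ : 0 < α - 1 := sub_pos.2 hα
  -- Working on (0, 2) keeps ρ = 1 strictly inside the range, so the curves agree for all r ≤ 1, and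
  -- r = 1 can start the regular problem.
  have hd : (1 : ℝ) < 2 ^ (α - 1) := Real.one_lt_rpow one_lt_two hκ
  have C := ((S.isProfileOn hm hc₂ subset_rfl).mono Ioo_subset_Ioi_self).isIntegralCurveOnIcc
    hα hc₀ two_pos hH hB hd
  have C' := ((S'.isProfileOn hm hc₂ subset_rfl).mono Ioo_subset_Ioi_self).isIntegralCurveOnIcc
    hα hc₀ two_pos hH' hB' hd
  have key : ∀ r ∈ Ioc (0 : ℝ) 1, h r = h' r ∧ p r = p' r := by
    intro r hr
    have hr0 : 0 < r := hr.1
    have hρ := Real.rpow_pos_of_pos hr0 (α - 1)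
    have h1 := C.eqOn (contDiff_profileField α lam m c₂) (continuous_profileParam hκ).continuousOn
      C' (by simp [profileCurve]) (x := r ^ (α - 1)) ⟨hρ.le, Real.rpow_le_one hr0.le hr.2 hκ.le⟩
    simp only [profileCurve, not_le.2 hρ, if_false, Real.rpow_rpow_inv hr0.le hκ.ne',
      Prod.mk.injEq] at h1
    have hX := Real.rpow_pos_of_pos hr0 α
    have h2 : h r = h' r := mul_left_cancel₀ hX.ne' (Real.log_injOn_pos
      (mul_pos hX (S r hr0).1) (mul_pos hX (S' r hr0).1) h1.1)
    refine ⟨h2, ?_⟩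
    have h3 := h1.2
    rw [h2] at h3
    linarith
  intro r hr
  rcases le_or_gt r 1 with hr1 | hr1
  · exact (key r ⟨hr, hr1⟩).1
  · have hsub : Icc 1 r ⊆ Ioi (0 : ℝ) := fun x hx => one_pos.trans_le hx.1
    obtain ⟨h1, h2⟩ := key 1 ⟨one_pos, le_rfl⟩
    exact (S.mono hsub).eqOn one_pos (S'.mono hsub) h1 h2 (right_mem_Icc.2 hr1.le)

/-- Existence of a solution on `(0, ∞)` with prescribed behaviour at `0`. -/
theorem exists_isSolitonOn {α lam m c₂ c₀ : ℝ} (c₁ : ℝ) (hα : 1 < α) (hlam : 0 ≤ lam)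
    (hm : m = α ^ 2 + 2 * α) (hc₂ : c₂ = m * (α - 1) / 2) (hc₀ : 0 < c₀) :
    ∃ h p : ℝ → ℝ, IsSolitonOn m lam h p (Ioi 0) ∧
      Tendsto (fun r => r ^ α * h r) (𝓝[>] 0) (𝓝 c₀) ∧
      Tendsto (fun r => (remainder α lam c₂ h p r - c₁) / r ^ (α - 1)) (𝓝[>] 0)
        (𝓝 (c₂ * (c₂ + m) / (2 * (α - 1) * c₀))) := by
  have hκ : 0 < α - 1 := sub_pos.2 hα
  obtain ⟨d, hd0, -, y, hy0, hy⟩ := exists_isIntegralCurveOnIcc_local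
    (contDiff_profileField α lam m c₂) one_pos
    (continuous_profileParam hκ).continuousOn (Real.log c₀, c₁)
  have hprof := hy.isProfileOn hα hd0.le
  have hb : 0 < d ^ (α - 1)⁻¹ := Real.rpow_pos_of_pos hd0 _
  obtain ⟨h, p, hsol, hh, hp⟩ := (hprof.isSolitonOn hm hc₂ Ioo_subset_Ioi_self).exists_extension
    (by rw [hm]; nlinarith) hlam hb
  have hnear : ∀ᶠ r in 𝓝[>] (0 : ℝ), r ∈ Ioo 0 (d ^ (α - 1)⁻¹) := Ioo_mem_nhdsGT hb
  refine ⟨h, p, hsol, (hy.tendsto_exp_fst hα hd0 hc₀ hy0).congr' (hnear.mono fun r hr => ?_),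
    (hy.tendsto_remainder hα hd0 hc₀ hy0).congr' (hnear.mono fun r hr => ?_)⟩
  · simp only
    rw [hh hr]
    exact (mul_div_cancel₀ _ (Real.rpow_pos_of_pos hr.1 α).ne').symm
  · simp only [remainder]
    rw [hh hr, hp hr]
    ring

/-! ### Translation to the formulation of the theorem. -/

theorem IsSolitonOn.contDiffOn {m lam : ℝ} {h p : ℝ → ℝ} (S : IsSolitonOn m lam h p (Ioi 0)) :
    ContDiffOn ℝ 2 h (Ioi 0) := by
  have hd : EqOn (deriv h) p (Ioi 0) := fun r hr => (S r hr).2.1.deriv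
  have hd2 : EqOn (deriv p) (fun r => solitonAccel m lam r (h r) (p r)) (Ioi 0) :=
    fun r hr => (S r hr).2.2.deriv
  have hc : ContinuousOn h (Ioi 0) := fun r hr => (S r hr).2.1.continuousAt.continuousWithinAt
  have hpc : ContinuousOn p (Ioi 0) := fun r hr => (S r hr).2.2.continuousAt.continuousWithinAt
  have hp : ContDiffOn ℝ 1 p (Ioi 0) := by
    rw [show (1 : WithTop ℕ∞) = 0 + 1 by rfl, contDiffOn_succ_iff_deriv_of_isOpen isOpen_Ioi]
    refine ⟨fun r hr => (S r hr).2.2.differentiableAt.differentiableWithinAt, by simp, ?_⟩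
    rw [contDiffOn_zero]
    refine ContinuousOn.congr ?_ hd2
    unfold solitonAccel
    refine ContinuousOn.div (by fun_prop) (by fun_prop) fun r hr => ?_
    have h1 : (0 : ℝ) < r := hr
    have h2 := (S r hr).1
    positivity
  rw [show (2 : WithTop ℕ∞) = 1 + 1 by rfl, contDiffOn_succ_iff_deriv_of_isOpen isOpen_Ioi]
  exact ⟨fun r hr => (S r hr).2.1.differentiableAt.differentiableWithinAt, by simp, hp.congr hd⟩

theorem IsSolitonOn.isSolitonSolution {n : ℕ} {lam : ℝ} {h p : ℝ → ℝ}
    (S : IsSolitonOn ((n : ℝ) - 1) lam h p (Ioi 0)) : IsSolitonSolution n lam h := by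
  refine ⟨S.contDiffOn, fun r hr => ⟨(S r hr).1, ?_⟩⟩
  have hev : deriv h =ᶠ[𝓝 r] p :=
    eventually_of_mem (Ioi_mem_nhds hr) fun x hx => (S x hx).2.1.deriv
  obtain ⟨h0, h1, h2⟩ := S r hr
  rw [hev.deriv_eq, h1.deriv, h2.deriv]
  unfold solitonAccel
  field_simp

theorem IsSolitonSolution.isSolitonOn {n : ℕ} {lam : ℝ} {h : ℝ → ℝ}
    (S : IsSolitonSolution n lam h) : IsSolitonOn ((n : ℝ) - 1) lam h (deriv h) (Ioi 0) := by
  intro r hr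
  have hr0 : (0 : ℝ) < r := hr
  obtain ⟨h0, heq⟩ := S.2 r hr
  have hC := S.1
  rw [show (2 : WithTop ℕ∞) = 1 + 1 by rfl, contDiffOn_succ_iff_deriv_of_isOpen isOpen_Ioi] at hC
  have hmem : Ioi (0 : ℝ) ∈ 𝓝 r := Ioi_mem_nhds hr
  refine ⟨h0, (hC.1.differentiableAt hmem).hasDerivAt, ?_⟩
  have h2 := ((hC.2.2.differentiableOn one_ne_zero).differentiableAt hmem).hasDerivAt
  refine h2.congr_deriv ?_
  unfold solitonAccel
  rw [← heq]
  field_simp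

/-- The last coefficient in the expansion of `r ^ α h`. -/
def lastCoeff (n : ℕ) (c₀ : ℝ) : ℝ :=
  (cTwo n ^ 2 + ((n : ℝ) - 1) * cTwo n) / (4 * c₀ * blowUpExponent n * (blowUpExponent n - 1))

theorem HasExpansion.tendsto {n : ℕ} {lam c₀ c₁ δ₀ : ℝ} (hδ : 0 < δ₀) {h : ℝ → ℝ}
    (H : HasExpansion n lam c₀ c₁ δ₀ h) :
    Tendsto (fun r => (r ^ blowUpExponent n * h r - profileExpansion (blowUpExponent n) lam c₀ c₁
      (cTwo n) (lastCoeff n c₀) r) / r ^ (2 * blowUpExponent n)) (𝓝[>] 0) (𝓝 0) := by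
  obtain ⟨e, he, heq⟩ := H
  refine he.congr' (eventually_of_mem (Ioc_mem_nhdsGT hδ) fun r hr => ?_)
  have hX := Real.rpow_pos_of_pos hr.1 (blowUpExponent n)
  have hX2 := Real.rpow_pos_of_pos hr.1 (2 * blowUpExponent n)
  rw [eq_div_iff hX2.ne', heq r hr.1 hr.2, ← mul_assoc, mul_one_div_cancel hX.ne', one_mul]
  unfold profileExpansion lastCoeff
  ring

/-- Any `δ₀` works: the error function is obtained by solving the expansion for it, and only its
limit at 0 matters. -/
theorem hasExpansion_of_tendsto {n : ℕ} {lam c₀ c₁ : ℝ} (δ₀ : ℝ) {h : ℝ → ℝ}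
    (H : Tendsto (fun r => (r ^ blowUpExponent n * h r - profileExpansion (blowUpExponent n) lam
      c₀ c₁ (cTwo n) (lastCoeff n c₀) r) / r ^ (2 * blowUpExponent n)) (𝓝[>] 0) (𝓝 0)) :
    HasExpansion n lam c₀ c₁ δ₀ h := by
  refine ⟨_, H, fun r hr _ => ?_⟩
  have hX := Real.rpow_pos_of_pos hr (blowUpExponent n)
  have hX2 := Real.rpow_pos_of_pos hr (2 * blowUpExponent n)
  rw [div_mul_cancel₀ _ hX2.ne', eq_comm, one_div_mul_eq_div, div_eq_iff hX.ne']
  unfold profileExpansion lastCoeff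
  ring

theorem IsSolitonOn.hasDerivExpansion {n : ℕ} {lam c₀ c₁ : ℝ} (δ₀ : ℝ) (hα : 1 < blowUpExponent n)
    (hc₀ : 0 < c₀) {h p : ℝ → ℝ} (S : IsSolitonOn ((n : ℝ) - 1) lam h p (Ioi 0))
    (H : Tendsto (fun r => (r ^ blowUpExponent n * h r - profileExpansion (blowUpExponent n) lam
      c₀ c₁ (cTwo n) (lastCoeff n c₀) r) / r ^ (2 * blowUpExponent n)) (𝓝[>] 0) (𝓝 0))
    (hB : Tendsto (fun r => (remainder (blowUpExponent n) lam (cTwo n) h p r - c₁) /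
      r ^ (blowUpExponent n - 1)) (𝓝[>] 0)
        (𝓝 (2 * blowUpExponent n * lastCoeff n c₀))) :
    HasDerivExpansion n lam c₀ c₁ δ₀ h := by
  -- Solving the definition of B for h_r and multiplying by r^(α+1), the error is -α times that of H
  -- plus that of B. The r^α terms cancel, and the last coefficient is 2αE - αE = αE.
  refine ⟨fun r => -blowUpExponent n * ((r ^ blowUpExponent n * h r -
      profileExpansion (blowUpExponent n) lam c₀ c₁ (cTwo n) (lastCoeff n c₀) r) /
        r ^ (2 * blowUpExponent n)) +
      ((remainder (blowUpExponent n) lam (cTwo n) h p r - c₁) / r ^ (blowUpExponent n - 1)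
        - 2 * blowUpExponent n * lastCoeff n c₀), ?_, fun r hr _ => ?_⟩
  · simpa using (H.const_mul (-blowUpExponent n)).add
      (hB.sub_const (2 * blowUpExponent n * lastCoeff n c₀))
  · rw [(S r hr).2.1.deriv]
    unfold profileExpansion lastCoeff remainder
    have hX := Real.rpow_pos_of_pos hr (blowUpExponent n)
    generalize blowUpExponent n = α at *
    generalize cTwo n = c₂ at *
    simp only [rpow_two_mul_eq_mul hr, rpow_add_one_eq_mul hr, Real.rpow_sub_one hr.ne']
    generalize r ^ α = X at *
    have h1 : α + 1 ≠ 0 := by linarith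
    have h2 : α - 1 ≠ 0 := by linarith
    have h3 : α ≠ 0 := by linarith
    have h5 : 2 * α + 2 = 2 * (α + 1) := by ring
    rw [h5]
    field_simp
    ring

theorem one_lt_blowUpExponent {n : ℕ} (hn : 4 < n) : 1 < blowUpExponent n := by
  have h1 : (2 : ℝ) < √(n : ℝ) := by
    rw [Real.lt_sqrt two_pos.le]
    have : (4 : ℝ) < n := by exact_mod_cast hn
    linarith
  unfold blowUpExponent
  linarith

theorem sub_one_eq_blowUpExponent (n : ℕ) :
    (n : ℝ) - 1 = blowUpExponent n ^ 2 + 2 * blowUpExponent n := by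
  have := Real.sq_sqrt (Nat.cast_nonneg (α := ℝ) n)
  unfold blowUpExponent
  linarith

theorem two_mul_lastCoeff {n : ℕ} (hα : 1 < blowUpExponent n) {c₀ : ℝ} (hc₀ : 0 < c₀) :
    2 * blowUpExponent n * lastCoeff n c₀ =
      cTwo n * (cTwo n + ((n : ℝ) - 1)) / (2 * (blowUpExponent n - 1) * c₀) := by
  unfold lastCoeff
  have h2 : blowUpExponent n - 1 ≠ 0 := by linarith
  have h3 : blowUpExponent n ≠ 0 := by linarith
  field_simp
  ring

end

theorem theorem1p2 (n : ℕ) (hn : 4 < n) (lam : ℝ) (hlam : 0 ≤ lam)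
    (c₀ : ℝ) (hc₀ : 0 < c₀) (c₁ : ℝ) :
    ∃ δ₀ : ℝ, 0 < δ₀ ∧ δ₀ < 1 ∧
      ∃ h : ℝ → ℝ,
        (IsSolitonSolution n lam h ∧ HasBlowUpRate (blowUpExponent n) c₀ h ∧
          HasExpansion n lam c₀ c₁ δ₀ h) ∧
        (∀ g : ℝ → ℝ, IsSolitonSolution n lam g →
          HasBlowUpRate (blowUpExponent n) c₀ g →
          HasExpansion n lam c₀ c₁ δ₀ g → EqOn g h (Ioi 0)) ∧
        HasDerivExpansion n lam c₀ c₁ δ₀ h := by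
  have hα := one_lt_blowUpExponent hn
  have hm := sub_one_eq_blowUpExponent n
  have hc₂ : cTwo n = ((n : ℝ) - 1) * (blowUpExponent n - 1) / 2 := rfl
  obtain ⟨h, p, S, hH, hB⟩ := exists_isSolitonOn c₁ hα hlam hm hc₂ hc₀
  have hexp := ((S.isProfileOn hm hc₂ subset_rfl).mono
    (Ioo_subset_Ioi_self : Ioo (0 : ℝ) 1 ⊆ Ioi 0)).tendsto_expansion hα one_pos hH hB
  have hα0 : 2 * blowUpExponent n ≠ 0 := by linarith
  rw [← two_mul_lastCoeff hα hc₀, mul_div_cancel_left₀ _ hα0] at hexp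
  rw [← two_mul_lastCoeff hα hc₀] at hB
  have remainder_tendsto : ∀ {g q : ℝ → ℝ}, IsSolitonOn ((n : ℝ) - 1) lam g q (Ioi 0) →
      HasBlowUpRate (blowUpExponent n) c₀ g → HasExpansion n lam c₀ c₁ (1 / 2) g →
      Tendsto (remainder (blowUpExponent n) lam (cTwo n) g q) (𝓝[>] 0) (𝓝 c₁) :=
    fun hg hr he => ((hg.isProfileOn hm hc₂ subset_rfl).mono
      (Ioo_subset_Ioi_self : Ioo (0 : ℝ) 1 ⊆ Ioi 0)).tendsto_remainder_of_expansion hα hc₀ one_pos hr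
        (he.tendsto one_half_pos)
  have hE : HasExpansion n lam c₀ c₁ (1 / 2) h := hasExpansion_of_tendsto _ hexp
  -- The solution lives on (0, ∞) and the error terms are only asymptotic, so 1/2 is an arbitrary
  -- choice in (0, 1).
  refine ⟨1 / 2, one_half_pos, one_half_lt_one, h, ⟨S.isSolitonSolution, hH, hE⟩,
    fun g hg hgr hge => ?_, S.hasDerivExpansion _ hα hc₀ hexp hB⟩
  exact hg.isSolitonOn.eqOn_of_tendsto hα hm hc₂ hc₀ S hgr hH
    (remainder_tendsto hg.isSolitonOn hgr hge) (remainder_tendsto S hH hE)
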